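/- Let $M$ be a smooth $n$-dimensional manifold (Hausdorff, second countable) and let $\Theta$ be a smooth symmetric $(2,0)$ tensor field on $M$ of constant rank, that is, a smooth family of symmetric bilinear forms on the cotangent spaces $T_x^*M$ such that the corresponding linear maps $\Theta_x:T_x^*M\to T_xM$, $\xi\mapsto\Theta_x(\xi,\cdot)$, all have the same rank. Then there exists a smooth torsion-free connection $\nabla$ on $TM$ with $\nabla\Theta=0$ if and only if the image distribution $\mathrm{Im}\,\Theta\subseteq TM$, with the fibres $\Theta_x(T_x^*M)\subseteq T_xM$, is integrable, that is, through every point of $M$ there passes an (immersed) submanifold whose tangent space at each of its points $y$ is $\Theta_y(T_y^*M)$. -/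

import Mathlib

open Bundle
open scoped Manifold ContDiff

namespace SymTensor

noncomputable section

section

/-- A (not necessarily smooth) `1`-form on the `n`-dimensional manifold `M`. -/
abbrev OneForm (n : ℕ) (M : Type*) [TopologicalSpace M]
    [ChartedSpace (EuclideanSpace ℝ (Fin n)) M] : Type _ :=
  Π x : M, TangentSpace (𝓡 n) x →L[ℝ] ℝ

/-- A (not necessarily smooth) `(2,0)` tensor field on `M`, treated as a family of linear maps
`T*ₓM → TₓM`; the corresponding bilinear form on `T*ₓM` is `(ξ, η) ↦ η (Θ x ξ)`. -/
abbrev Tensor20 (n : ℕ) (M : Type*) [TopologicalSpace M]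
    [ChartedSpace (EuclideanSpace ℝ (Fin n)) M] : Type _ :=
  Π x : M, (TangentSpace (𝓡 n) x →L[ℝ] ℝ) →L[ℝ] TangentSpace (𝓡 n) x

/-- A connection in the tangent bundle of `M` (with no smoothness imposed). In Mathlib's convention
`cov Y x v` is the covariant derivative at `x` of the vector field `Y` in the direction `v`. -/
abbrev Connection (n : ℕ) (M : Type*) [TopologicalSpace M]
    [ChartedSpace (EuclideanSpace ℝ (Fin n)) M] [IsManifold (𝓡 n) ∞ M] : Type _ :=
  CovariantDerivative (𝓡 n) (EuclideanSpace ℝ (Fin n)) (TangentSpace (𝓡 n) : M → Type _)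

variable {n : ℕ} {M : Type*} [TopologicalSpace M] [ChartedSpace (EuclideanSpace ℝ (Fin n)) M]

/-- Symmetry: `Θ(ξ, η) = Θ(η, ξ)`. -/
def Tensor20.IsSymmetric (Θ : Tensor20 n M) : Prop :=
  ∀ (x : M) (ξ η : TangentSpace (𝓡 n) x →L[ℝ] ℝ), η (Θ x ξ) = ξ (Θ x η)

/-- The image distribution `Im Θ`, with the fibre `{Θ x ξ | ξ ∈ T*ₓM}` at `x`. -/
def Tensor20.image (Θ : Tensor20 n M) (x : M) : Submodule ℝ (TangentSpace (𝓡 n) x) :=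
  LinearMap.range (Θ x : (TangentSpace (𝓡 n) x →L[ℝ] ℝ) →ₗ[ℝ] TangentSpace (𝓡 n) x)

/-- Constant rank: all the maps `Θ x : T*ₓM → TₓM` have the same rank. -/
def Tensor20.HasConstantRank (Θ : Tensor20 n M) : Prop :=
  ∃ r : ℕ, ∀ x : M, Module.finrank ℝ (Θ.image x) = r

/-- A distribution `D` on `M` is integrable if every point of `M` lies on an integral manifold
of `D`: a submanifold, given here by an injective smooth parametrization `f : U → M` with an open
domain `U` in some `ℝᵏ`, which is an immersion and has the tangent space `D (f u)` at each point
`f u`. -/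
def IsIntegrableDistribution (D : Π x : M, Submodule ℝ (TangentSpace (𝓡 n) x)) : Prop :=
  ∀ p : M, ∃ (k : ℕ) (U : Set (EuclideanSpace ℝ (Fin k))) (f : EuclideanSpace ℝ (Fin k) → M),
    IsOpen U ∧ ContMDiffOn (𝓡 k) (𝓡 n) ∞ f U ∧ Set.InjOn f U ∧ p ∈ f '' U ∧
    ∀ u ∈ U, Function.Injective (mfderiv (𝓡 k) (𝓡 n) f u) ∧
      LinearMap.range (mfderiv (𝓡 k) (𝓡 n) f u :
        TangentSpace (𝓡 k) u →ₗ[ℝ] TangentSpace (𝓡 n) (f u)) = D (f u)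

variable [IsManifold (𝓡 n) ∞ M]

/-- Differentiability at `x` of a `1`-form, as a section of the cotangent bundle. -/
def OneForm.DifferentiableAt (α : OneForm n M) (x : M) : Prop :=
  MDifferentiableAt (𝓡 n) ((𝓡 n).prod 𝓘(ℝ, EuclideanSpace ℝ (Fin n) →L[ℝ] ℝ))
    (fun y ↦ TotalSpace.mk' (EuclideanSpace ℝ (Fin n) →L[ℝ] ℝ)
      (E := fun z : M ↦ (TangentSpace (𝓡 n) z →L[ℝ] ℝ)) y (α y)) x

/-- Smoothness of a `(2,0)` tensor field, as a section of the bundle `Hom(T*M, TM)`. -/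
def Tensor20.IsSmooth (Θ : Tensor20 n M) : Prop :=
  ContMDiff (𝓡 n) ((𝓡 n).prod 𝓘(ℝ, (EuclideanSpace ℝ (Fin n) →L[ℝ] ℝ) →L[ℝ]
      EuclideanSpace ℝ (Fin n))) ∞
    (fun y ↦ TotalSpace.mk' ((EuclideanSpace ℝ (Fin n) →L[ℝ] ℝ) →L[ℝ] EuclideanSpace ℝ (Fin n))
      (E := fun z : M ↦ ((TangentSpace (𝓡 n) z →L[ℝ] ℝ) →L[ℝ] TangentSpace (𝓡 n) z)) y (Θ y))

/-- `Y ↦ d_v(α(Y)) - α(∇_v Y)` for a tangent vector `v` at `x`, which is the covariant derivative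
`∇_v α` of the `1`-form `α` evaluated on the vector field `Y`. -/
def dualDerivAux (cov : Connection n M) (α : OneForm n M) (x : M) (v : TangentSpace (𝓡 n) x)
    (Y : Π y : M, TangentSpace (𝓡 n) y) : ℝ :=
  mvfderiv (𝓡 n) (fun y ↦ α y (Y y)) x v - α x (cov Y x v)

theorem OneForm.DifferentiableAt.apply {α : OneForm n M} {x : M} (hα : α.DifferentiableAt x)
    {Y : Π y : M, TangentSpace (𝓡 n) y}
    (hY : MDifferentiableAt (𝓡 n) ((𝓡 n).prod 𝓘(ℝ, EuclideanSpace ℝ (Fin n)))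
      (fun y ↦ TotalSpace.mk' (EuclideanSpace ℝ (Fin n)) y (Y y)) x) :
    MDifferentiableAt (𝓡 n) 𝓘(ℝ, ℝ) (fun y ↦ α y (Y y)) x := by
  have h : MDifferentiableAt (𝓡 n) ((𝓡 n).prod 𝓘(ℝ, ℝ))
      (fun y ↦ TotalSpace.mk' ℝ (E := Bundle.Trivial M ℝ) y (α y (Y y))) x :=
    MDifferentiableAt.clm_bundle_apply (E₂ := Bundle.Trivial M ℝ) hα hY
  rw [mdifferentiableAt_totalSpace] at h
  simpa using h.2

theorem tensorialAt_dualDerivAux (cov : Connection n M) {α : OneForm n M} {x : M}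
    (hα : α.DifferentiableAt x) (v : TangentSpace (𝓡 n) x) :
    TensorialAt (𝓡 n) (EuclideanSpace ℝ (Fin n)) (dualDerivAux cov α x v) x where
  smul hf hY := by
    simp [dualDerivAux, mvfderiv_fun_mul hf (hα.apply hY),
      cov.isCovariantDerivativeOn.leibniz hY hf]
    ring
  add hY hY' := by
    simp [dualDerivAux, mvfderiv_fun_add (hα.apply hY) (hα.apply hY'),
      cov.isCovariantDerivativeOn.add hY hY']
    abel

/-- The covariant derivative `∇_v α` at `x` of a `1`-form `α` differentiable at `x`, with respect
to the dual connection: `(∇_v α)(Y) = d_v(α(Y)) - α(∇_v Y)`. -/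
def dualDeriv (cov : Connection n M) {α : OneForm n M} {x : M} (hα : α.DifferentiableAt x)
    (v : TangentSpace (𝓡 n) x) : TangentSpace (𝓡 n) x →L[ℝ] ℝ :=
  TensorialAt.mkHom (dualDerivAux cov α x v) x (tensorialAt_dualDerivAux cov hα v)

theorem dualDeriv_apply (cov : Connection n M) {α : OneForm n M} {x : M}
    (hα : α.DifferentiableAt x) {Y : Π y : M, TangentSpace (𝓡 n) y}
    (hY : MDifferentiableAt (𝓡 n) ((𝓡 n).prod 𝓘(ℝ, EuclideanSpace ℝ (Fin n)))
      (fun y ↦ TotalSpace.mk' (EuclideanSpace ℝ (Fin n)) y (Y y)) x)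
    (v : TangentSpace (𝓡 n) x) :
    dualDeriv cov hα v (Y x) =
      mvfderiv (𝓡 n) (fun y ↦ α y (Y y)) x v - α x (cov Y x v) :=
  TensorialAt.mkHom_apply (tensorialAt_dualDerivAux cov hα v) hY

/-- `∇Θ = 0`, that is, `(∇_v Θ)ξ = ∇_v(Θξ) - Θ(∇_v ξ)` vanishes for all vectors `v` and all
`1`-forms `ξ`. -/
def Tensor20.IsParallel (Θ : Tensor20 n M) (cov : Connection n M) : Prop :=
  ∀ (x : M) (ξ : OneForm n M) (hξ : ξ.DifferentiableAt x) (v : TangentSpace (𝓡 n) x),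
    cov (fun y ↦ Θ y (ξ y)) x v = Θ x (dualDeriv cov hξ v)

/-- Integrability of a `(2,0)` tensor: some smooth torsion-free connection makes it parallel. -/
def Tensor20.IsIntegrable (Θ : Tensor20 n M) : Prop :=
  ∃ cov : Connection n M,
    CovariantDerivative.ContMDiffCovariantDerivative cov ∞ ∧ cov.torsion = 0 ∧ Θ.IsParallel cov

end

end

end SymTensor

/-! Both directions pass through involutivity of Im Θ, expressed in charts. In a chart around a
point, let C be a complement of the kernel of Θ at that point, carried along with constant
coefficients. Near the point Θ is nondegenerate on C, and inverting this restriction gives a smooth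
symmetric G with ΘGΘ = Θ; constant rank is used for that identity (`exists_isGeneralizedInverseOn`).
Then P = ΘG projects onto Im Θ along the annihilator of C, a kernel independent of the point. With Q
= 1 - P one has Q(∂_X Θ)ξ = (∂_X P)(Θξ), so involutivity becomes the symmetry of (∂_{Θξ} P)(Θη) in ξ
and η (`IsInvolutiveAt`).

From a connection to integral manifolds: if ∇ is torsion-free and ∇Θ = 0, then [Θξ, Θη] = Θ(∇_{Θξ} η
- ∇_{Θη} ξ) lies in Im Θ. Since the kernel of P is constant, an integral manifold is a solution of
the total differential equation f' = P(f) on a fixed complement of that kernel, and involutivity is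
exactly its integrability condition (`exists_hasFDerivAt_of_symm`).

From integral manifolds to a connection: symmetry of the second derivative of a parametrization
gives involutivity. Explicit Christoffel symbols built from Θ, G and ∂Θ, Levi-Civita along the
leaves with a correction across them, are then symmetric and make Θ parallel (`christoffelAux_symm`,
`christoffelAux_parallel`). Both conditions are affine in the connection, so a partition of unity
glues the local solutions. -/

namespace SymTensor

noncomputable section

set_option maxSynthPendingDepth 3

/-! ### Frobenius theorem for total differential equations. -/

section TotalDifferentialEquation

open Set Metric Topology Asymptotics
open scoped NNReal

variable {V E F : Type*} [NormedAddCommGroup V] [NormedSpace ℝ V]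
  [NormedAddCommGroup E] [NormedSpace ℝ E] [NormedAddCommGroup F] [NormedSpace ℝ F]

/-- Uniform first and second order Taylor bounds for a `C²` function on a small ball. -/
theorem exists_taylor_bounds {A : E → F} {x₀ : E} {s : Set E} (hs : s ∈ 𝓝 x₀)
    (hA : ContDiffAt ℝ 2 A x₀) :
    ∃ R > 0, ∃ C > 0, closedBall x₀ R ⊆ s ∧ ∀ x ∈ closedBall x₀ R,
      DifferentiableAt ℝ A x ∧ ‖A x‖ ≤ C ∧ ‖fderiv ℝ A x‖ ≤ C ∧
      ∀ y ∈ closedBall x₀ R, ‖A y - A x‖ ≤ C * ‖y - x‖ ∧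
        ‖A y - A x - fderiv ℝ A x (y - x)‖ ≤ C * ‖y - x‖ * ‖y - x‖ := by
  have hd : ContDiffAt ℝ 1 (fderiv ℝ A) x₀ := hA.fderiv_right (by norm_num)
  obtain ⟨K, t, ht, hK⟩ := hd.exists_lipschitzOnWith
  have h1 : ∀ᶠ x in 𝓝 x₀, ‖fderiv ℝ A x‖ < ‖fderiv ℝ A x₀‖ + 1 :=
    hd.continuousAt.norm.eventually_lt continuousAt_const (by simp)
  have h2 : ∀ᶠ x in 𝓝 x₀, ‖A x‖ < ‖A x₀‖ + 1 :=
    hA.continuousAt.norm.eventually_lt continuousAt_const (by simp)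
  have h3 : ∀ᶠ x in 𝓝 x₀, DifferentiableAt ℝ A x := by
    filter_upwards [hA.eventually (by simp)] with x hx using hx.differentiableAt (by simp)
  obtain ⟨R, hR, hball⟩ := nhds_basis_closedBall.mem_iff.1
    (Filter.inter_mem hs (Filter.inter_mem ht (h1.and (h2.and h3))))
  set C : ℝ := ‖fderiv ℝ A x₀‖ + 1 + (‖A x₀‖ + 1) + K with hC
  have hKC : (K : ℝ) ≤ C := by have := norm_nonneg (A x₀); have := norm_nonneg (fderiv ℝ A x₀); linarith
  have hC1 : ‖fderiv ℝ A x₀‖ + 1 ≤ C := by have := norm_nonneg (A x₀); have := K.2; simp only [hC]; linarith [K.coe_nonneg]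
  have hC2 : ‖A x₀‖ + 1 ≤ C := by have := norm_nonneg (fderiv ℝ A x₀); linarith [K.coe_nonneg]
  have hcv := convex_closedBall x₀ R
  refine ⟨R, hR, C, by positivity, fun x hx ↦ (hball hx).1, fun x hx ↦ ?_⟩
  obtain ⟨-, hxt, hx1, hx2, hx3⟩ := hball hx
  refine ⟨hx3, hx2.le.trans hC2, hx1.le.trans hC1, fun y hy ↦ ⟨?_, ?_⟩⟩
  · exact hcv.norm_image_sub_le_of_norm_fderiv_le (𝕜 := ℝ) (fun z hz ↦ (hball hz).2.2.2.2)
      (fun z hz ↦ (hball hz).2.2.1.le.trans hC1) hx hy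
  · have hseg : segment ℝ x y ⊆ closedBall x₀ R := hcv.segment_subset hx hy
    refine (convex_segment x y).norm_image_sub_le_of_norm_hasFDerivWithin_le' (𝕜 := ℝ)
      (fun z hz ↦ ((hball (hseg hz)).2.2.2.2).hasFDerivAt.hasFDerivWithinAt)
      (fun z hz ↦ ?_) (left_mem_segment ℝ x y) (right_mem_segment ℝ x y)
    have := hK.dist_le_mul z (hball (hseg hz)).2.1 x hxt
    rw [dist_eq_norm, dist_eq_norm] at this
    refine this.trans (mul_le_mul hKC ?_ (norm_nonneg _) (by positivity))
    obtain ⟨a, b, ha, hb, hab, rfl⟩ := hz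
    have : a • x + b • y - x = b • (y - x) := by
      obtain rfl : a = 1 - b := by linarith
      module
    rw [this, norm_smul, Real.norm_of_nonneg hb]
    exact mul_le_of_le_one_left (norm_nonneg _) (by linarith)

/-- Integral curves on `[0, 1]` of a vector field which is small compared with the radius of the
ball on which it is controlled. -/
theorem exists_integralCurve_unit_interval [CompleteSpace E] {X : E → E} {x₀ : E} {R : ℝ} (hR : 0 < R)
    {K : ℝ≥0} (hK : LipschitzOnWith K X (closedBall x₀ R))
    (hX : ∀ x ∈ closedBall x₀ R, ‖X x‖ ≤ R) :
    ∃ γ : ℝ → E, γ 0 = x₀ ∧ ∀ t ∈ Icc (0 : ℝ) 1, γ t ∈ closedBall x₀ R ∧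
      HasDerivWithinAt γ (X (γ t)) (Icc 0 1) t := by
  lift R to ℝ≥0 using hR.le
  -- Speed at most `R` for time 1 moves a point at most `R`, so one number serves as radius and as
  -- speed bound; the set of initial values has radius 0.
  have hf : IsPicardLindelof (fun _ ↦ X) (tmin := 0) (tmax := 1) ⟨0, by simp⟩ x₀ R 0 R K :=
    { lipschitzOnWith := fun _ _ ↦ hK
      continuousOn := fun _ _ ↦ continuousOn_const
      norm_le := fun _ _ ↦ hX
      mul_max_le := by simp }
  -- The Picard fixed point is used directly because it also carries the information that the curve
  -- stays in the ball.
  obtain ⟨α, hα⟩ := ODE.FunSpace.exists_isFixedPt_next hf (mem_closedBall_self le_rfl)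
  refine ⟨α.compProj, ?_, fun t ht ↦ ⟨α.compProj_mem_closedBall hf.mul_max_le, ?_⟩⟩
  · have := α.compProj_val (t := ⟨0, by simp⟩)
    rw [← hα, ODE.FunSpace.next_apply₀] at this
    exact hα ▸ this
  · refine (ODE.hasDerivWithinAt_picard_Icc (t₀ := 0) (by simp) hf.continuousOn_uncurry
      α.continuous_compProj.continuousOn (fun _ _ ↦ α.compProj_mem_closedBall hf.mul_max_le)
      x₀ ht).congr_of_mem (fun s hs ↦ ?_) ht
    rw [ODE.FunSpace.compProj_of_mem hs]
    nth_rw 1 [← hα]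
    rw [ODE.FunSpace.next_apply]

/-- Grönwall's inequality on `[0, 1]` for a function vanishing at `0`. -/
theorem norm_le_of_norm_deriv_le_mul_add {f f' : ℝ → E} {K ε : ℝ} (hK : 0 < K)
    (hf : ∀ t ∈ Icc (0 : ℝ) 1, HasDerivWithinAt f (f' t) (Icc 0 1) t) (h0 : f 0 = 0)
    (hf' : ∀ t ∈ Icc (0 : ℝ) 1, ‖f' t‖ ≤ K * ‖f t‖ + ε) (hε : 0 ≤ ε) :
    ∀ t ∈ Icc (0 : ℝ) 1, ‖f t‖ ≤ (Real.exp K - 1) / K * ε := by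
  intro t ht
  have h := norm_le_gronwallBound_of_norm_deriv_right_le (f := f) (f' := f') (δ := 0) (K := K)
    (ε := ε) (a := 0) (b := 1) (fun t ht ↦ (hf t ht).continuousWithinAt)
    (fun x hx ↦ ((hf x (Ico_subset_Icc_self hx)).mono_of_mem_nhdsWithin
      (Icc_mem_nhdsGE_of_mem hx))) (by simp [h0])
    (fun x hx ↦ hf' x (Ico_subset_Icc_self hx)) t ht
  refine (h.trans (gronwallBound_mono le_rfl hε hK.le (by simpa using ht.2 : t - 0 ≤ 1))).trans
    (le_of_eq ?_)
  rw [gronwallBound_of_K_ne_0 hK.ne']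
  simp
  ring

/-- **Frobenius theorem** for a total differential equation `f' = A ∘ f`: if the integrability
condition holds near `x₀`, there is a local solution through `x₀`. -/
theorem exists_hasFDerivAt_of_symm [CompleteSpace E] {A : E → V →L[ℝ] E} {x₀ : E} {s : Set E}
    (hs : s ∈ 𝓝 x₀) (hA : ContDiffAt ℝ 2 A x₀)
    (hsymm : ∀ x ∈ s, ∀ v w, fderiv ℝ A x (A x v) w = fderiv ℝ A x (A x w) v) :
    ∃ ε > 0, ∃ f : V → E, f 0 = x₀ ∧ ∀ u ∈ ball (0 : V) ε, f u ∈ s ∧ HasFDerivAt f (A (f u)) u := by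
  obtain ⟨R, hR, C, hC, hRs, hb⟩ := exists_taylor_bounds hs hA
  -- For ‖w‖ < ε the field x ↦ A x w has norm at most C ε = R, so its integral curve lives up to
  -- time 1. The solution will be f(w) = γ_w(1).
  set ε := R / C with hε
  have hε0 : 0 < ε := by positivity
  have hex : ∀ w ∈ ball (0 : V) ε, ∃ γ : ℝ → E, γ 0 = x₀ ∧ ∀ t ∈ Icc (0 : ℝ) 1,
      γ t ∈ closedBall x₀ R ∧ HasDerivWithinAt γ (A (γ t) w) (Icc 0 1) t := by
    intro w hw
    rw [mem_ball_zero_iff] at hw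
    refine exists_integralCurve_unit_interval (X := fun x ↦ A x w) hR
      (K := C.toNNReal * ‖w‖₊) (LipschitzOnWith.of_dist_le_mul fun x hx y hy ↦ ?_)
      fun x hx ↦ ?_
    · rw [dist_eq_norm, dist_eq_norm, ← sub_apply]
      refine (ContinuousLinearMap.le_opNorm _ _).trans ?_
      have := ((hb y hy).2.2.2 x hx).1
      calc _ ≤ C * ‖x - y‖ * ‖w‖ := by gcongr
        _ = _ := by simp [Real.coe_toNNReal _ hC.le]; ring
    · calc _ ≤ ‖A x‖ * ‖w‖ := ContinuousLinearMap.le_opNorm _ _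
        _ ≤ C * ε := by gcongr; exact (hb x hx).2.1
        _ = R := by rw [hε]; field_simp
  choose! γ hγ0 hγ using hex
  have h01 : (1 : ℝ) ∈ Icc (0 : ℝ) 1 := by simp
  -- The Grönwall factor for the rate C ε on [0, 1].
  set N := (Real.exp (C * ε) - 1) / (C * ε) with hN
  have hN0 : 0 ≤ N := by
    have : 1 ≤ Real.exp (C * ε) := Real.one_le_exp (by positivity)
    rw [hN]; apply div_nonneg <;> [linarith; positivity]
  -- A remainder quadratic in v, which makes A (γ w 1) the derivative of w ↦ γ w 1.
  have key : ∀ w v, w ∈ ball (0 : V) ε → w + v ∈ ball (0 : V) ε →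
      ‖γ (w + v) 1 - γ w 1 - A (γ w 1) v‖ ≤
        N * (C * (N * C) * (N * C) * ε + C * (N * C)) * ‖v‖ ^ 2 := by
    intro w v hw hwv
    have hwε : ‖w‖ ≤ ε := (mem_ball_zero_iff.1 hw).le
    have hwvε : ‖w + v‖ ≤ ε := (mem_ball_zero_iff.1 hwv).le
    have hΔ : ∀ t ∈ Icc (0 : ℝ) 1, ‖γ (w + v) t - γ w t‖ ≤ N * (C * ‖v‖) := by
      refine norm_le_of_norm_deriv_le_mul_add (by positivity)
        (fun t ht ↦ ((hγ _ hwv t ht).2.sub (hγ _ hw t ht).2)) (by simp [hγ0 _ hw, hγ0 _ hwv])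
        (fun t ht ↦ ?_) (by positivity)
      have e : A (γ (w + v) t) (w + v) - A (γ w t) w =
        (A (γ (w + v) t) - A (γ w t)) (w + v) + A (γ w t) v := by
        simp
        abel
      rw [e]
      have b1 := ((hb _ (hγ _ hw t ht).1).2.2.2 _ (hγ _ hwv t ht).1).1
      have b2 := (hb _ (hγ _ hw t ht).1).2.1
      calc _ ≤ ‖A (γ (w + v) t) - A (γ w t)‖ * ‖w + v‖ + ‖A (γ w t)‖ * ‖v‖ :=
            (norm_add_le _ _).trans
              (add_le_add (ContinuousLinearMap.le_opNorm _ _) (ContinuousLinearMap.le_opNorm _ _))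
        _ ≤ C * ‖γ (w + v) t - γ w t‖ * ε + C * ‖v‖ := by gcongr
        _ = _ := by ring
    -- The variation of γ_w in the direction v should be t A(γ_w(t)) v. Grönwall is applied to the
    -- deviation from it, with the first-order bound `hΔ` controlling the inhomogeneous term.
    have hδ := norm_le_of_norm_deriv_le_mul_add (K := C * ε)
      (f := fun t ↦ γ (w + v) t - γ w t - t • A (γ w t) v)
      (ε := (C * (N * C) * (N * C) * ε + C * (N * C)) * ‖v‖ ^ 2) (by positivity)
      (fun t ht ↦ ((hγ _ hwv t ht).2.sub (hγ _ hw t ht).2).sub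
        ((hasDerivWithinAt_id t _).smul
          (((hb _ (hγ _ hw t ht).1).1.hasFDerivAt.comp_hasDerivWithinAt t
            (hγ _ hw t ht).2).clm_apply (hasDerivWithinAt_const t _ v))))
      (by simp [hγ0 _ hw, hγ0 _ hwv]) (fun t ht ↦ ?_) (by positivity) 1 h01
    · simpa [hN, mul_assoc] using hδ
    · have hx := (hγ _ hw t ht).1
      have hy := (hγ _ hwv t ht).1
      have hd := hΔ t ht
      set x := γ w t
      set y := γ (w + v) t
      obtain ⟨-, b0, b1, b⟩ := hb x hx
      obtain ⟨b2, b3⟩ := b y hy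
      have hsy := hsymm x (hRs hx) w v
      -- Integrability enters here: `hsy` exchanges w and v in the derivative of t A(γ_w) v, so it
      -- combines with the linearization of A y w. The term `A x 0` is the contribution of the
      -- derivative of the constant v.
      have e : A y (w + v) - A x w - (id t • (fderiv ℝ A x (A x w) v + A x 0) + (1 : ℝ) • A x v) =
          (A y - A x - fderiv ℝ A x (y - x)) w + (A y - A x) v
            + fderiv ℝ A x (y - x - t • A x v) w := by
        simp [hsy]
        abel
      simp only [Function.comp_apply] at *
      rw [e]
      calc _ ≤ ‖A y - A x - fderiv ℝ A x (y - x)‖ * ‖w‖ + ‖A y - A x‖ * ‖v‖ +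
            ‖fderiv ℝ A x‖ * ‖y - x - t • A x v‖ * ‖w‖ := by
            refine (norm_add₃_le).trans (add_le_add_three (ContinuousLinearMap.le_opNorm _ _)
              (ContinuousLinearMap.le_opNorm _ _) (ContinuousLinearMap.le_opNorm₂ _ _ _))
        _ ≤ (C * ‖y - x‖ * ‖y - x‖) * ε + (C * ‖y - x‖) * ‖v‖ +
            C * ‖y - x - t • A x v‖ * ε := by gcongr
        _ ≤ (C * (N * (C * ‖v‖)) * (N * (C * ‖v‖))) * ε + (C * (N * (C * ‖v‖))) * ‖v‖ +
            C * ‖y - x - t • A x v‖ * ε := by gcongr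
        _ = _ := by ring
  refine ⟨ε, hε0, fun w ↦ γ w 1, ?_, fun w hw ↦ ⟨hRs (hγ w hw 1 h01).1, ?_⟩⟩
  · have h0 : (0 : V) ∈ ball (0 : V) ε := mem_ball_self hε0
    have := norm_le_of_norm_deriv_le_mul_add (f := fun t ↦ γ 0 t - x₀) (ε := 0) one_pos
      (fun t ht ↦ (hγ 0 h0 t ht).2.sub_const x₀) (by simp [hγ0 0 h0])
      (fun t ht ↦ by simp) le_rfl 1 h01
    simpa [sub_eq_zero] using this
  · rw [hasFDerivAt_iff_isLittleO_nhds_zero]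
    refine IsBigO.trans_isLittleO (g := fun v : V ↦ ‖v‖ ^ 2) ?_ (isLittleO_norm_pow_id one_lt_two)
    refine IsBigO.of_bound (N * (C * (N * C) * (N * C) * ε + C * (N * C))) ?_
    have : ∀ᶠ v in 𝓝 (0 : V), w + v ∈ ball (0 : V) ε := by
      have hc : ContinuousAt (fun v : V ↦ w + v) 0 := by fun_prop
      exact hc.eventually (isOpen_ball.mem_nhds (by simpa using hw))
    filter_upwards [this] with v hv
    simpa using key w v hw hv

/-- Solutions of `f' = A ∘ f` are smooth when `A` is smooth. -/
theorem contDiffOn_of_hasFDerivAt_comp {A : E → V →L[ℝ] E} {f : V → E} {U : Set V} {s : Set E}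
    (hU : IsOpen U) (hA : ContDiffOn ℝ ∞ A s) (hfs : MapsTo f U s)
    (hf : ∀ u ∈ U, HasFDerivAt f (A (f u)) u) : ContDiffOn ℝ ∞ f U := by
  rw [contDiffOn_infty]
  intro k
  induction k with
  | zero =>
    exact contDiffOn_zero.2 fun u hu ↦ (hf u hu).continuousAt.continuousWithinAt
  | succ k ih =>
    rw [Nat.cast_succ, contDiffOn_succ_iff_fderiv_of_isOpen hU]
    refine ⟨fun u hu ↦ (hf u hu).differentiableAt.differentiableWithinAt, by simp, ?_⟩
    exact ((hA.of_le (by exact_mod_cast le_top)).comp ih hfs).congr fun u hu ↦ (hf u hu).fderiv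

end TotalDifferentialEquation

/-! ### Generalized inverses, involutivity and integral manifolds in coordinates. -/

section Coordinates

open Set Metric Topology ContinuousLinearMap

variable {E : Type*} [NormedAddCommGroup E] [NormedSpace ℝ E]

theorem exists_injective_isCompl_ker_range {W F : Type*} [AddCommGroup W] [Module ℝ W]
    [FiniteDimensional ℝ W] [AddCommGroup F] [Module ℝ F] (T : W →ₗ[ℝ] F) {r : ℕ}
    (hr : Module.finrank ℝ T.range = r) :
    ∃ ι : EuclideanSpace ℝ (Fin r) →ₗ[ℝ] W, Function.Injective ι ∧ IsCompl T.ker ι.range := by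
  obtain ⟨C, hC⟩ := Submodule.exists_isCompl T.ker
  have hfr : Module.finrank ℝ C = r := by
    rw [← hr]
    have h1 := Submodule.finrank_add_eq_of_isCompl hC
    have h2 := T.finrank_range_add_finrank_ker
    omega
  let L : EuclideanSpace ℝ (Fin r) ≃ₗ[ℝ] C := LinearEquiv.ofFinrankEq _ C (by simp [hfr])
  refine ⟨C.subtype ∘ₗ (L : EuclideanSpace ℝ (Fin r) →ₗ[ℝ] C), C.injective_subtype.comp L.injective, ?_⟩
  have : (C.subtype ∘ₗ (L : EuclideanSpace ℝ (Fin r) →ₗ[ℝ] C)).range = C := by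
    rw [LinearMap.range_comp, LinearEquiv.range, Submodule.map_top, Submodule.range_subtype]
  rwa [this]

/-- `G` is a smooth symmetric generalized inverse of `Θ` on `s`, such that moreover the kernels of
the projections `Θ u ∘ G u` onto the range of `Θ u` are all the same. -/
structure IsGeneralizedInverseOn (Θ : E → (E →L[ℝ] ℝ) →L[ℝ] E) (G : E → E →L[ℝ] E →L[ℝ] ℝ)
    (s : Set E) : Prop where
  isOpen : IsOpen s
  contDiffOn_tensor : ContDiffOn ℝ ∞ Θ s
  contDiffOn : ContDiffOn ℝ ∞ G s
  tensor_symm : ∀ u ∈ s, ∀ ξ η : E →L[ℝ] ℝ, η (Θ u ξ) = ξ (Θ u η)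
  symm : ∀ u ∈ s, ∀ v w, G u v w = G u w v
  comp_comp : ∀ u ∈ s, ∀ u' ∈ s, ∀ v, G u (Θ u' (G u' v)) = G u v
  tensor_comp_comp : ∀ u ∈ s, ∀ ξ, Θ u (G u (Θ u ξ)) = Θ u ξ

theorem exists_isGeneralizedInverseOn [FiniteDimensional ℝ E] {Θ : E → (E →L[ℝ] ℝ) →L[ℝ] E}
    {O : Set E} (hO : IsOpen O) (hΘ : ContDiffOn ℝ ∞ Θ O)
    (hsymm : ∀ u ∈ O, ∀ ξ η : E →L[ℝ] ℝ, η (Θ u ξ) = ξ (Θ u η)) {r : ℕ}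
    (hr : ∀ u ∈ O, Module.finrank ℝ (Θ u : (E →L[ℝ] ℝ) →ₗ[ℝ] E).range = r)
    {u₀ : E} (hu₀ : u₀ ∈ O) :
    ∃ (G : E → E →L[ℝ] E →L[ℝ] ℝ) (s : Set E), s ⊆ O ∧ u₀ ∈ s ∧ IsGeneralizedInverseOn Θ G s := by
  let K := EuclideanSpace ℝ (Fin r)
  have hKr : Module.finrank ℝ K = r := by simp [K]
  obtain ⟨ι', hι', hC⟩ := exists_injective_isCompl_ker_range
    (Θ u₀ : (E →L[ℝ] ℝ) →ₗ[ℝ] E) (hr u₀ hu₀)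
  let ι : K →L[ℝ] (E →L[ℝ] ℝ) := LinearMap.toContinuousLinearMap ι'
  -- The bilinear form Θ u restricted to the fixed complement `ι.range` of the kernel at `u₀`.
  let A : E → K →L[ℝ] K →L[ℝ] ℝ := fun u ↦ ι.flip ∘L Θ u ∘L ι
  have hAapp : ∀ u a b, A u a b = ι b (Θ u (ι a)) := fun u a b ↦ rfl
  -- If `A u₀ a = 0`, then Θ u₀ (ι a) is killed by the complement, and by symmetry of Θ also by the
  -- kernel; hence it vanishes.
  have hAinj : Function.Injective (A u₀) := by
    rw [injective_iff_map_eq_zero]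
    intro a ha
    have h0 : Θ u₀ (ι a) = 0 := by
      refine SeparatingDual.eq_zero_of_forall_dual_eq_zero (R := ℝ) fun ξ ↦ ?_
      have hξ : ξ ∈ (Θ u₀ : (E →L[ℝ] ℝ) →ₗ[ℝ] E).ker ⊔ ι'.range :=
        hC.sup_eq_top ▸ Submodule.mem_top
      obtain ⟨k, hk, _, ⟨b, rfl⟩, rfl⟩ := Submodule.mem_sup.1 hξ
      have h1 : ι' b (Θ u₀ (ι a)) = 0 := by
        have := hAapp u₀ a b
        rw [ha] at this
        exact this.symm
      have h2 : k (Θ u₀ (ι a)) = 0 := by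
        rw [hsymm u₀ hu₀, show Θ u₀ k = 0 from hk, map_zero]
      simp [h1, h2]
    have h1 : ι' a = 0 := hC.disjoint.le_bot ⟨h0, a, rfl⟩
    exact (map_eq_zero_iff ι' hι').1 h1
  have hdual : Module.finrank ℝ K = Module.finrank ℝ (K →L[ℝ] ℝ) := by
    rw [← (LinearMap.toContinuousLinearMap (𝕜 := ℝ) (E := K) (F' := ℝ)).finrank_eq]
    exact (Subspace.dual_finrank_eq (K := ℝ) (V := K)).symm
  let e : K ≃L[ℝ] (K →L[ℝ] ℝ) :=
    (LinearEquiv.ofInjectiveOfFinrankEq (A u₀ : K →ₗ[ℝ] (K →L[ℝ] ℝ)) hAinj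
      hdual).toContinuousLinearEquiv
  have he : A u₀ = e := by ext a b; rfl
  have hAs : ContDiffOn ℝ ∞ A O := contDiffOn_const.clm_comp (hΘ.clm_comp contDiffOn_const)
  set s : Set E := O ∩ A ⁻¹' range ((↑) : (K ≃L[ℝ] (K →L[ℝ] ℝ)) → K →L[ℝ] K →L[ℝ] ℝ) with hs
  have hinv : ∀ u ∈ s, ∀ α, A u ((A u).inverse α) = α := by
    rintro u ⟨-, e', he'⟩ α
    rw [← he']
    simp
  have hinv' : ∀ u ∈ s, ∀ a, (A u).inverse (A u a) = a := by
    rintro u ⟨-, e', he'⟩ α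
    rw [← he']
    simp
  have hsO : s ⊆ O := inter_subset_left
  set G : E → E →L[ℝ] E →L[ℝ] ℝ := fun u ↦ ι ∘L (A u).inverse ∘L ι.flip with hG
  have hGapp : ∀ u v w, G u v w = (ι.flip w) ((A u).inverse (ι.flip v)) := fun u v w ↦ rfl
  have hcomp : ∀ u ∈ s, ∀ u' ∈ s, ∀ v, G u (Θ u' (G u' v)) = G u v := by
    intro u hu u' hu' v
    change ι ((A u).inverse (A u' ((A u').inverse (ι.flip v)))) = _
    rw [hinv u' hu']
    rfl
  refine ⟨G, s, hsO, ⟨hu₀, e, he.symm⟩, ?_, hΘ.mono hsO, ?_, fun u hu ↦ hsymm u (hsO hu), ?_,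
    hcomp, ?_⟩
  · exact hAs.continuousOn.isOpen_inter_preimage hO (ContinuousLinearEquiv.isOpen)
  · refine contDiffOn_const.clm_comp (ContDiffOn.clm_comp (fun u hu ↦ ?_) contDiffOn_const)
    obtain ⟨e', he'⟩ := hu.2
    have h1 : ContDiffAt ℝ ∞ ContinuousLinearMap.inverse (A u) := he' ▸ contDiffAt_map_inverse e'
    exact h1.comp_contDiffWithinAt u ((hAs u hu.1).mono hsO)
  · intro u hu v w
    rw [hGapp, hGapp]
    have hsA : ∀ a b, A u a b = A u b a := fun a b ↦ by rw [hAapp, hAapp, hsymm u hu.1]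
    conv_lhs => rw [← hinv u hu (ι.flip w)]
    conv_rhs => rw [← hinv u hu (ι.flip v)]
    exact hsA _ _
  · intro u hu ξ
    -- On C the map P Θ is injective, so P has rank at least `r`. Constant rank then forces its
    -- range to be all of the range of Θ u, on which the idempotent P is the identity.
    set Pu : E →ₗ[ℝ] E := ((Θ u ∘L G u : E →L[ℝ] E) : E →ₗ[ℝ] E) with hPu
    have hle : Pu.range ≤ (Θ u : (E →L[ℝ] ℝ) →ₗ[ℝ] E).range := by
      rintro _ ⟨v, rfl⟩
      exact ⟨G u v, rfl⟩
    let J : K →ₗ[ℝ] Pu.range :=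
      (Pu.codRestrict Pu.range fun v ↦ ⟨v, rfl⟩) ∘ₗ ((Θ u ∘L ι : K →L[ℝ] E) : K →ₗ[ℝ] E)
    have hJ : Function.Injective J := by
      intro a b hab
      have h1 : Θ u (G u (Θ u (ι a))) = Θ u (G u (Θ u (ι b))) := congrArg Subtype.val hab
      have h2 := congrArg ι.flip h1
      have h3 : ∀ a, ι.flip (Θ u (G u (Θ u (ι a)))) = A u a := by
        intro a
        change A u ((A u).inverse (A u a)) = _
        rw [hinv u hu]
      rw [h3, h3] at h2
      rw [← hinv' u hu a, ← hinv' u hu b, h2]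
    have hrange : Pu.range = (Θ u : (E →L[ℝ] ℝ) →ₗ[ℝ] E).range := by
      refine Submodule.eq_of_le_of_finrank_le hle ?_
      rw [hr u hu.1, ← hKr]
      exact LinearMap.finrank_le_finrank_of_injective hJ
    have : Θ u ξ ∈ Pu.range := hrange ▸ ⟨ξ, rfl⟩
    obtain ⟨v, hv⟩ := this
    have hv' : Θ u (G u v) = Θ u ξ := hv
    rw [← hv', hcomp u hu u hu]

namespace IsGeneralizedInverseOn

variable {Θ : E → (E →L[ℝ] ℝ) →L[ℝ] E} {G : E → E →L[ℝ] E →L[ℝ] ℝ} {s : Set E} {u : E}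

section

variable (h : IsGeneralizedInverseOn Θ G s)
include h

theorem contDiffOn_proj : ContDiffOn ℝ ∞ (fun u ↦ Θ u ∘L G u) s :=
  h.contDiffOn_tensor.clm_comp h.contDiffOn

theorem differentiableAt_tensor (hu : u ∈ s) : DifferentiableAt ℝ Θ u :=
  (h.contDiffOn_tensor.contDiffAt (h.isOpen.mem_nhds hu)).differentiableAt (by simp)

theorem differentiableAt_proj (hu : u ∈ s) : DifferentiableAt ℝ (fun u ↦ Θ u ∘L G u) u :=
  (h.contDiffOn_proj.contDiffAt (h.isOpen.mem_nhds hu)).differentiableAt (by simp)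

/-- The derivative of the identity `P ∘ Θ = Θ`. -/
theorem fderiv_proj_tensor (hu : u ∈ s) (X : E) (ξ : E →L[ℝ] ℝ) :
    fderiv ℝ (fun u ↦ Θ u ∘L G u) u X (Θ u ξ) + Θ u (G u (fderiv ℝ Θ u X ξ)) =
      fderiv ℝ Θ u X ξ := by
  have h1 := (h.differentiableAt_proj hu).hasFDerivAt.clm_apply
    ((h.differentiableAt_tensor hu).hasFDerivAt.clm_apply (hasFDerivAt_const ξ u))
  have h2 := (h.differentiableAt_tensor hu).hasFDerivAt.clm_apply (hasFDerivAt_const ξ u)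
  have h3 : (fun u ↦ (Θ u ∘L G u) (Θ u ξ)) =ᶠ[𝓝 u] fun u ↦ Θ u ξ := by
    filter_upwards [h.isOpen.mem_nhds hu] with v hv using h.tensor_comp_comp v hv ξ
  have h4 := congrArg (fun L : E →L[ℝ] E ↦ L X) ((h2.congr_of_eventuallyEq h3).unique h1)
  simp at h4
  rw [add_comm]
  exact h4.symm

/-- The derivative of the identity `P u ∘ P v = P u` in `u`. -/
theorem fderiv_proj_proj (hu : u ∈ s) (X w : E) :
    fderiv ℝ (fun u ↦ Θ u ∘L G u) u X (Θ u (G u w)) = fderiv ℝ (fun u ↦ Θ u ∘L G u) u X w := by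
  have hP := (h.differentiableAt_proj hu).hasFDerivAt
  have h1 := hP.clm_apply (hasFDerivAt_const (Θ u (G u w)) u)
  have h2 := hP.clm_apply (hasFDerivAt_const w u)
  have h3 : (fun v ↦ (Θ v ∘L G v) (Θ u (G u w))) =ᶠ[𝓝 u] fun v ↦ (Θ v ∘L G v) w := by
    filter_upwards [h.isOpen.mem_nhds hu] with v hv
    simp [h.comp_comp v hv u hu]
  have h4 := congrArg (fun L : E →L[ℝ] E ↦ L X) ((h2.congr_of_eventuallyEq h3).unique h1)
  simp at h4
  rw [h4]

end

/-- The integrability condition for the range of `Θ`, at the point `u`. -/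
def IsInvolutiveAt (Θ : E → (E →L[ℝ] ℝ) →L[ℝ] E) (G : E → E →L[ℝ] E →L[ℝ] ℝ) (u : E) : Prop :=
  ∀ ξ η, fderiv ℝ (fun u ↦ Θ u ∘L G u) u (Θ u ξ) (Θ u η) =
    fderiv ℝ (fun u ↦ Θ u ∘L G u) u (Θ u η) (Θ u ξ)

/-- Applying Q to ∂_{Θξ}Θ η - ∂_{Θη}Θ ξ turns it into the difference of the two sides of the
involutivity condition, and Q kills Im Θ. -/
theorem isInvolutiveAt_of_bracket (h : IsGeneralizedInverseOn Θ G s) (hu : u ∈ s)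
    (hbr : ∀ ξ η, ∃ ζ, fderiv ℝ Θ u (Θ u ξ) η - fderiv ℝ Θ u (Θ u η) ξ = Θ u ζ) :
    IsInvolutiveAt Θ G u := by
  intro ξ η
  obtain ⟨ζ, hζ⟩ := hbr ξ η
  have h1 := h.fderiv_proj_tensor hu (Θ u ξ) η
  have h2 := h.fderiv_proj_tensor hu (Θ u η) ξ
  have h3 := h.tensor_comp_comp u hu ζ
  rw [← hζ, map_sub, map_sub] at h3
  rw [← sub_eq_zero]
  rw [← eq_sub_iff_add_eq] at h1 h2
  rw [h1, h2]
  rw [← sub_eq_zero] at h3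
  rw [← neg_eq_zero, ← h3]
  abel

/-- Differentiating P(g) g' v = g' v in the direction w gives (∂_{g'w} P)(g' v) = Q g''(w, v), which
is symmetric in v and w. -/
theorem isInvolutiveAt_of_integralManifold {V : Type*} [NormedAddCommGroup V] [NormedSpace ℝ V]
    (h : IsGeneralizedInverseOn Θ G s) {g : V → E} {a : V} (hg : ContDiffAt ℝ ∞ g a)
    (ha : g a ∈ s)
    (hrange : ∀ᶠ b in 𝓝 a, (fderiv ℝ g b : V →ₗ[ℝ] E).range =
      (Θ (g b) : (E →L[ℝ] ℝ) →ₗ[ℝ] E).range) :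
    IsInvolutiveAt Θ G (g a) := by
  have key : ∀ v w, fderiv ℝ (fun u ↦ Θ u ∘L G u) (g a) (fderiv ℝ g a w) (fderiv ℝ g a v) +
      Θ (g a) (G (g a) (fderiv ℝ (fderiv ℝ g) a w v)) = fderiv ℝ (fderiv ℝ g) a w v := by
    intro v w
    have hg' : DifferentiableAt ℝ (fderiv ℝ g) a :=
      (hg.fderiv_right (m := 1) (by simpa [one_add_one_eq_two] using ENat.LEInfty.out)).differentiableAt (by simp)
    have h2 := hg'.hasFDerivAt.clm_apply (hasFDerivAt_const v a)
    have h1 := ((h.differentiableAt_proj ha).hasFDerivAt.comp a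
      (hg.differentiableAt (by simp)).hasFDerivAt).clm_apply h2
    have h3 : (fun b ↦ ((fun u ↦ Θ u ∘L G u) ∘ g) b (fderiv ℝ g b v)) =ᶠ[𝓝 a]
        fun b ↦ fderiv ℝ g b v := by
      filter_upwards [hrange, hg.continuousAt.preimage_mem_nhds (h.isOpen.mem_nhds ha)] with b hb hbs
      obtain ⟨ξ, hξ⟩ : fderiv ℝ g b v ∈ (Θ (g b) : (E →L[ℝ] ℝ) →ₗ[ℝ] E).range := hb ▸ ⟨v, rfl⟩
      change Θ (g b) ξ = fderiv ℝ g b v at hξ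
      simp [← hξ, h.tensor_comp_comp _ hbs]
    have h4 := congrArg (fun L : V →L[ℝ] E ↦ L w) ((h2.congr_of_eventuallyEq h3).unique h1)
    simp at h4
    rw [add_comm]
    exact h4.symm
  have hsymm : ∀ v w, fderiv ℝ (fderiv ℝ g) a w v = fderiv ℝ (fderiv ℝ g) a v w := by
    intro v w
    exact (hg.isSymmSndFDerivAt (by simpa using ENat.LEInfty.out)).eq w v
  intro ξ η
  obtain ⟨v, hv⟩ : Θ (g a) ξ ∈ (fderiv ℝ g a : V →ₗ[ℝ] E).range :=
    hrange.self_of_nhds ▸ ⟨ξ, rfl⟩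
  obtain ⟨w, hw⟩ : Θ (g a) η ∈ (fderiv ℝ g a : V →ₗ[ℝ] E).range :=
    hrange.self_of_nhds ▸ ⟨η, rfl⟩
  change fderiv ℝ g a v = _ at hv
  change fderiv ℝ g a w = _ at hw
  have h1 := key v w
  have h2 := key w v
  rw [← eq_sub_iff_add_eq] at h1 h2
  rw [← hv, ← hw, h1, h2, hsymm]

/-- Existence of an integral manifold through a point near which `Im Θ` is involutive. -/
theorem exists_integralManifold [FiniteDimensional ℝ E] (h : IsGeneralizedInverseOn Θ G s)
    (hinv : ∀ u ∈ s, IsInvolutiveAt Θ G u) (hu : u ∈ s) :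
    ∃ (k : ℕ) (U : Set (EuclideanSpace ℝ (Fin k))) (f : EuclideanSpace ℝ (Fin k) → E),
      IsOpen U ∧ ContDiffOn ℝ ∞ f U ∧ InjOn f U ∧ MapsTo f U s ∧ u ∈ f '' U ∧ ∀ a ∈ U,
        Function.Injective (fderiv ℝ f a) ∧ (fderiv ℝ f a : EuclideanSpace ℝ (Fin k) →ₗ[ℝ] E).range =
          (Θ (f a) : (E →L[ℝ] ℝ) →ₗ[ℝ] E).range := by
  set P : E → E →L[ℝ] E := fun u ↦ Θ u ∘L G u with hP
  set D : Submodule ℝ E := (P u : E →ₗ[ℝ] E).range with hD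
  let L : EuclideanSpace ℝ (Fin (Module.finrank ℝ D)) ≃L[ℝ] D :=
    ContinuousLinearEquiv.ofFinrankEq (by simp)
  -- The equation f' = P(f) L, where `L` parametrizes the range `D` of P at the given point.
  let A : E → EuclideanSpace ℝ (Fin (Module.finrank ℝ D)) →L[ℝ] E :=
    fun v ↦ P v ∘L D.subtypeL ∘L (L : EuclideanSpace ℝ (Fin (Module.finrank ℝ D)) →L[ℝ] D)
  have hA : ContDiffOn ℝ ∞ A s := h.contDiffOn_proj.clm_comp contDiffOn_const
  have hs := h.isOpen.mem_nhds hu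
  have hAsymm : ∀ x ∈ s, ∀ v w, fderiv ℝ A x (A x v) w = fderiv ℝ A x (A x w) v := by
    intro x hx v w
    have hd : ∀ X w, fderiv ℝ A x X w = fderiv ℝ P x X (L w) := by
      intro X w
      have h1 := (h.differentiableAt_proj hx).hasFDerivAt.clm_comp
        (hasFDerivAt_const (D.subtypeL ∘L (L : EuclideanSpace ℝ (Fin (Module.finrank ℝ D)) →L[ℝ] D)) x)
      rw [h1.fderiv]
      simp [hP]
    -- As P has constant kernel, ∂P does not distinguish L w from P(L w), a vector of Im Θ to which
    -- involutivity applies.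
    rw [hd, hd, ← h.fderiv_proj_proj hx _ (L w), ← h.fderiv_proj_proj hx _ (L v)]
    exact hinv x hx (G x (L v)) (G x (L w))
  obtain ⟨ε, hε, f, hf0, hf⟩ := exists_hasFDerivAt_of_symm hs
    ((hA.contDiffAt hs).of_le ENat.LEInfty.out) hAsymm
  have hPP : ∀ x ∈ s, ∀ y ∈ s, ∀ v, P x (P y v) = P x v := by
    intro x hx y hy v
    simp [hP, h.comp_comp x hx y hy]
  -- Projecting by P u recovers `L` from every A x. So f is an immersion, and P u ∘ f differs from
  -- `L` by a constant, whence f is injective.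
  have hPL : ∀ x ∈ s, ∀ v, P u (A x v) = L v := by
    intro x hx v
    change P u (P x (L v)) = _
    rw [hPP u hu x hx]
    obtain ⟨z, hz⟩ := (L v).2
    rw [← hz]
    exact hPP u hu u hu z
  refine ⟨_, ball 0 ε, f, isOpen_ball, contDiffOn_of_hasFDerivAt_comp isOpen_ball hA
    (fun a ha ↦ (hf a ha).1) (fun a ha ↦ (hf a ha).2), ?_, fun a ha ↦ (hf a ha).1,
    ⟨0, mem_ball_self hε, hf0⟩, fun a ha ↦ ?_⟩
  · have hconst : ∀ a ∈ ball (0 : EuclideanSpace ℝ (Fin (Module.finrank ℝ D))) ε,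
        HasFDerivWithinAt (fun a ↦ P u (f a) - L a) (0 : _ →L[ℝ] E) (ball 0 ε) a := by
      intro a ha
      have h1 := ((P u).hasFDerivAt.comp a (hf a ha).2).sub
        ((D.subtypeL ∘L (L : EuclideanSpace ℝ (Fin (Module.finrank ℝ D)) →L[ℝ] D)).hasFDerivAt (x := a))
      refine (h1.congr_fderiv ?_).hasFDerivWithinAt
      ext1 v
      simpa [sub_eq_zero] using hPL (f a) (hf a ha).1 v
    intro a ha b hb hab
    have h1 := (convex_ball (0 : EuclideanSpace ℝ (Fin (Module.finrank ℝ D)))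
      ε).norm_image_sub_le_of_norm_hasFDerivWithin_le (𝕜 := ℝ) (C := 0) hconst (by simp) ha hb
    simp only [zero_mul, norm_le_zero_iff, hab, sub_sub_sub_cancel_left, sub_eq_zero] at h1
    exact L.injective (Subtype.ext h1)
  · obtain ⟨hfa, hfd⟩ := hf a ha
    rw [hfd.fderiv]
    constructor
    · intro v w hvw
      have h1 := hPL (f a) hfa v
      rw [hvw, hPL (f a) hfa w] at h1
      exact L.injective (Subtype.ext h1.symm)
    · apply le_antisymm
      · rintro _ ⟨v, rfl⟩
        exact ⟨G (f a) (L v), rfl⟩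
      · rintro _ ⟨ξ, rfl⟩
        refine ⟨L.symm ⟨P u (Θ (f a) ξ), ⟨_, rfl⟩⟩, ?_⟩
        change P (f a) (L (L.symm _)) = Θ (f a) ξ
        rw [L.apply_symm_apply]
        change P (f a) (P u _) = _
        rw [hPP _ hfa u hu]
        exact h.tensor_comp_comp _ hfa ξ

end IsGeneralizedInverseOn

end Coordinates

/-! ### Christoffel symbols making Θ parallel. -/

section Christoffel

open Set Metric Topology ContinuousLinearMap

variable {E : Type*} [NormedAddCommGroup E] [NormedSpace ℝ E]

/-- The Christoffel symbols of a connection that makes a tensor parallel, in terms of its value `θ`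
and its derivative `T` at a point, and of a generalized inverse `g` of `θ`. -/
def christoffelAux (θ : (E →L[ℝ] ℝ) →L[ℝ] E) (g : E →L[ℝ] E →L[ℝ] ℝ)
    (T : E →L[ℝ] (E →L[ℝ] ℝ) →L[ℝ] E) : E →L[ℝ] E →L[ℝ] E :=
  let P : E →L[ℝ] E := θ ∘L g
  let Q : E →L[ℝ] E := .id ℝ E - P
  let B : E →L[ℝ] E →L[ℝ] E := (compL ℝ E (E →L[ℝ] ℝ) E).flip g ∘L T
  let c : E →L[ℝ] E →L[ℝ] E →L[ℝ] ℝ :=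
    (compL ℝ E (E →L[ℝ] E) (E →L[ℝ] ℝ)).flip B.flip ∘L compL ℝ E E ℝ ∘L g;
  -(compL ℝ E E E Q ∘L (B + B.flip - B ∘L P) + (1 / 2 : ℝ) •
    (compL ℝ E E E P ∘L (B + B.flip) - compL ℝ E (E →L[ℝ] ℝ) E θ ∘L c))

/-- Write B(X, Y) = (∂_X Θ)(G Y). The part with factor 1/2 is the Koszul formula for the metric G
along the leaves, using ∂G = -G(∂Θ)G as for an inverse. Parallelism forces the Q-part of Γ(X, Y) to
be -Q B(X, Y) for Y in Im Θ; the symmetric extension to all Y is -Q(B(X, Y) + B(Y, X) - B(PX, Y)).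
-/
theorem christoffelAux_apply (θ : (E →L[ℝ] ℝ) →L[ℝ] E) (g : E →L[ℝ] E →L[ℝ] ℝ)
    (T : E →L[ℝ] (E →L[ℝ] ℝ) →L[ℝ] E) (X Y : E) :
    christoffelAux θ g T X Y =
      -((T X (g Y) + T Y (g X) - T (θ (g X)) (g Y)
          - θ (g (T X (g Y) + T Y (g X) - T (θ (g X)) (g Y))))
        + (1 / 2 : ℝ) • (θ (g (T X (g Y) + T Y (g X))) - θ (g X ∘L T.flip (g Y)))) := by
  have : ((compL ℝ E (E →L[ℝ] ℝ) E).flip g ∘L T).flip Y = T.flip (g Y) := by ext; rfl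
  simp only [christoffelAux, neg_apply, _root_.add_apply, comp_apply, _root_.sub_apply, compL_apply, flip_apply, _root_.smul_apply, ContinuousLinearMap.id_apply, this]

variable {θ : (E →L[ℝ] ℝ) →L[ℝ] E} {g : E →L[ℝ] E →L[ℝ] ℝ} {T : E →L[ℝ] (E →L[ℝ] ℝ) →L[ℝ] E}

/-- The only terms not visibly symmetric are Q B(PX, Y), handled by involutivity `hQ'` for G X and G
Y, and the Koszul term, handled by symmetry of ∂Θ. -/
theorem christoffelAux_symm 
    (hT : ∀ X (ξ η : E →L[ℝ] ℝ), η (T X ξ) = ξ (T X η))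
    (hQ' : ∀ ξ η, T (θ ξ) η - θ (g (T (θ ξ) η)) = T (θ η) ξ - θ (g (T (θ η) ξ))) (X Y : E) :
    christoffelAux θ g T X Y = christoffelAux θ g T Y X := by
  have hc : g X ∘L T.flip (g Y) = g Y ∘L T.flip (g X) := by
    ext Z
    exact hT _ _ _
  have h1 := hQ' (g X) (g Y)
  rw [christoffelAux_apply, christoffelAux_apply, hc, add_comm (T X (g Y))]
  congr 2
  simp only [map_sub]
  rw [sub_sub_sub_comm, h1, sub_sub_sub_comm]

theorem christoffelAux_parallel (hθ : ∀ ξ η : E →L[ℝ] ℝ, η (θ ξ) = ξ (θ η))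
    (hg : ∀ v w, g v w = g w v)
    (hT : ∀ X (ξ η : E →L[ℝ] ℝ), η (T X ξ) = ξ (T X η))
    (hQ : ∀ X ξ, T X ξ - θ (g (T X ξ)) = T X (g (θ ξ)) - θ (g (T X (g (θ ξ)))))
    (hQ' : ∀ ξ η, T (θ ξ) η - θ (g (T (θ ξ) η)) = T (θ η) ξ - θ (g (T (θ η) ξ)))
    (X : E) (ξ : E →L[ℝ] ℝ) :
    T X ξ + christoffelAux θ g T X (θ ξ) + θ (ξ ∘L christoffelAux θ g T X) = 0 := by
  have hgξ : ∀ (ξ : E →L[ℝ] ℝ) v, g (θ ξ) v = ξ (θ (g v)) := fun ξ v ↦ by rw [hg, hθ]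
  have key : ∀ ξ η : E →L[ℝ] ℝ, η (christoffelAux θ g T X (θ ξ)) =
      -(η (T X (g (θ ξ))) - g (θ η) (T X (g (θ ξ)))
        + (1 / 2 : ℝ) * (g (θ η) (T X (g (θ ξ))) + g (θ η) (T (θ ξ) (g X))
          - g (θ ξ) (T (θ η) (g X)))) := by
    intro ξ η
    -- For Y = θ ξ this says Q B(Y, X) = Q B(PX, Y), so these two terms cancel in the Q-part.
    have h1 : T (θ ξ) (g X) - θ (g (T (θ ξ) (g X))) =
        T (θ (g X)) (g (θ ξ)) - θ (g (T (θ (g X)) (g (θ ξ)))) := by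
      rw [hQ', hQ]
    have h2 := congrArg η h1
    have h3 : η (θ (g X ∘L T.flip (g (θ ξ)))) = g (θ ξ) (T (θ η) (g X)) := by
      rw [hθ]
      exact hT _ _ _
    rw [christoffelAux_apply]
    simp only [map_sub, map_add, map_neg, map_smul, smul_eq_mul, h3, hgξ] at h2 ⊢
    linarith
  refine SeparatingDual.eq_zero_of_forall_dual_eq_zero (R := ℝ) fun η ↦ ?_
  have h1 : η (θ (ξ ∘L christoffelAux θ g T X)) = ξ (christoffelAux θ g T X (θ η)) := by
    rw [hθ]
    rfl
  -- Between the two instances of `key` the derivatives along θ ξ and θ η cancel. What remains is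
  -- that ∂_X Θ vanishes on the pair ξ - G Θ ξ, η - G Θ η of elements of ker Θ, which is `e1`.
  rw [map_add, map_add, h1, key, key]
  have e1 := congrArg η (hQ X ξ)
  have e2 := congrArg ξ (hQ X η)
  have e3 := hT X (g (θ ξ)) (g (θ η))
  have e4 := hT X ξ (g (θ η))
  have e5 := hT X ξ η
  have e6 := hT X (g (θ ξ)) η
  simp only [map_sub, ← hgξ] at e1 e2
  linarith

/-- The Christoffel symbols, in the domain of a generalized inverse `G` of `Θ`, of a connection
for which `Θ` is parallel. -/
def christoffel (Θ : E → (E →L[ℝ] ℝ) →L[ℝ] E) (G : E → E →L[ℝ] E →L[ℝ] ℝ) (u : E) :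
    E →L[ℝ] E →L[ℝ] E :=
  christoffelAux (Θ u) (G u) (fderiv ℝ Θ u)

namespace IsGeneralizedInverseOn

variable {Θ : E → (E →L[ℝ] ℝ) →L[ℝ] E} {G : E → E →L[ℝ] E →L[ℝ] ℝ} {s : Set E} {u : E}
  (h : IsGeneralizedInverseOn Θ G s)
include h

theorem contDiffOn_christoffel [FiniteDimensional ℝ E] : ContDiffOn ℝ ∞ (christoffel Θ G) s := by
  have hΘ := h.contDiffOn_tensor
  have hG := h.contDiffOn
  have hT : ContDiffOn ℝ ∞ (fderiv ℝ Θ) s := hΘ.fderiv_of_isOpen h.isOpen (by simp)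
  have hGX (X : E) : ContDiffOn ℝ ∞ (fun u ↦ G u X) s := hG.clm_apply contDiffOn_const
  have hTX (X Y : E) : ContDiffOn ℝ ∞ (fun u ↦ fderiv ℝ Θ u X (G u Y)) s :=
    (hT.clm_apply contDiffOn_const).clm_apply (hGX Y)
  have hTP (X Y : E) : ContDiffOn ℝ ∞ (fun u ↦ fderiv ℝ Θ u (Θ u (G u X)) (G u Y)) s :=
    (hT.clm_apply (hΘ.clm_apply (hGX X))).clm_apply (hGX Y)
  have hP {f : E → E} (hf : ContDiffOn ℝ ∞ f s) : ContDiffOn ℝ ∞ (fun u ↦ Θ u (G u (f u))) s :=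
    hΘ.clm_apply (hG.clm_apply hf)
  refine contDiffOn_clm_apply.2 fun X ↦ contDiffOn_clm_apply.2 fun Y ↦ ?_
  have hc : ContDiffOn ℝ ∞ (fun u ↦ G u X ∘L (fderiv ℝ Θ u).flip (G u Y)) s :=
    contDiffOn_clm_apply.2 fun Z ↦ (hGX X).clm_apply (hTX Z Y)
  simp only [christoffel, christoffelAux_apply]
  have h1 := (hTX X Y).add (hTX Y X)
  have h2 := h1.sub (hTP X Y)
  exact ((h2.sub (hP h2)).add (contDiffOn_const.smul ((hP h1).sub (hΘ.clm_apply hc)))).neg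

theorem fderiv_tensor_symm (hu : u ∈ s) (X : E) (ξ η : E →L[ℝ] ℝ) :
    η (fderiv ℝ Θ u X ξ) = ξ (fderiv ℝ Θ u X η) := by
  have hd (ξ η : E →L[ℝ] ℝ) := η.hasFDerivAt.comp u
    ((h.differentiableAt_tensor hu).hasFDerivAt.clm_apply (hasFDerivAt_const ξ u))
  have he : (fun v ↦ η (Θ v ξ)) =ᶠ[𝓝 u] fun v ↦ ξ (Θ v η) := by
    filter_upwards [h.isOpen.mem_nhds hu] with v hv using h.tensor_symm v hv ξ η
  have := congrArg (fun L : E →L[ℝ] ℝ ↦ L X) ((hd ξ η).unique ((hd η ξ).congr_of_eventuallyEq he))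
  simpa using this

/-- The source of both hypotheses `hQ` and `hQ'`: the right side depends on ξ only through Θ ξ, and
involutivity is stated in terms of it. -/
theorem fderiv_tensor_sub (hu : u ∈ s) (X : E) (ξ : E →L[ℝ] ℝ) :
    fderiv ℝ Θ u X ξ - Θ u (G u (fderiv ℝ Θ u X ξ)) =
      fderiv ℝ (fun u ↦ Θ u ∘L G u) u X (Θ u ξ) := by
  rw [← h.fderiv_proj_tensor hu X ξ]
  nth_rw 2 [h.fderiv_proj_tensor hu X ξ]
  abel

theorem christoffel_symm (hu : u ∈ s) (hinv : IsInvolutiveAt Θ G u) (X Y : E) :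
    christoffel Θ G u X Y = christoffel Θ G u Y X :=
  christoffelAux_symm (h.fderiv_tensor_symm hu)
    (fun ξ η ↦ by rw [h.fderiv_tensor_sub hu, h.fderiv_tensor_sub hu, hinv]) X Y

theorem christoffel_parallel (hu : u ∈ s) (hinv : IsInvolutiveAt Θ G u) (X : E)
    (ξ : E →L[ℝ] ℝ) :
    fderiv ℝ Θ u X ξ + christoffel Θ G u X (Θ u ξ) + Θ u (ξ ∘L christoffel Θ G u X) = 0 :=
  christoffelAux_parallel (h.tensor_symm u hu) (h.symm u hu)
    (h.fderiv_tensor_symm hu)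
    (fun X ξ ↦ by rw [h.fderiv_tensor_sub hu, h.fderiv_tensor_sub hu, h.tensor_comp_comp u hu])
    (fun ξ η ↦ by rw [h.fderiv_tensor_sub hu, h.fderiv_tensor_sub hu, hinv]) X ξ

end IsGeneralizedInverseOn

end Christoffel

/-! ### Coordinate representations of vector fields, forms and tensors. -/

section Charts

open Set Topology

variable {n : ℕ} {M : Type*} [TopologicalSpace M] [ChartedSpace (EuclideanSpace ℝ (Fin n)) M]
  [IsManifold (𝓡 n) ∞ M]

/-- The derivative at `x` of the chart at `c`. -/
def chartDiff (c x : M) : TangentSpace (𝓡 n) x →L[ℝ] EuclideanSpace ℝ (Fin n) :=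
  (trivializationAt (EuclideanSpace ℝ (Fin n)) (TangentSpace (𝓡 n)) c).continuousLinearMapAt ℝ x

/-- The inverse of the derivative at `x` of the chart at `c`. -/
def chartDiffSymm (c x : M) : EuclideanSpace ℝ (Fin n) →L[ℝ] TangentSpace (𝓡 n) x :=
  (trivializationAt (EuclideanSpace ℝ (Fin n)) (TangentSpace (𝓡 n)) c).symmL ℝ x

variable {c x : M}

theorem mem_baseSet_of_mem_source (hx : x ∈ (extChartAt (𝓡 n) c).source) :
    x ∈ (trivializationAt (EuclideanSpace ℝ (Fin n))
      (TangentSpace (𝓡 n) : M → Type _) c).baseSet := by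
  simpa using hx

@[simp]
theorem chartDiffSymm_chartDiff (hx : x ∈ (extChartAt (𝓡 n) c).source)
    (v : TangentSpace (𝓡 n) x) : chartDiffSymm c x (chartDiff c x v) = v :=
  Trivialization.symmL_continuousLinearMapAt _ (mem_baseSet_of_mem_source hx) v

@[simp]
theorem chartDiff_chartDiffSymm (hx : x ∈ (extChartAt (𝓡 n) c).source)
    (v : EuclideanSpace ℝ (Fin n)) : chartDiff c x (chartDiffSymm c x v) = v :=
  Trivialization.continuousLinearMapAt_symmL _ (mem_baseSet_of_mem_source hx) v

theorem hasMFDerivAt_extChartAt_chartDiff (hx : x ∈ (extChartAt (𝓡 n) c).source) :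
    HasMFDerivAt (𝓡 n) 𝓘(ℝ, EuclideanSpace ℝ (Fin n)) (extChartAt (𝓡 n) c) x (chartDiff c x) := by
  have hx' : x ∈ (chartAt (EuclideanSpace ℝ (Fin n)) c).source := by simpa using hx
  have h := (mdifferentiableAt_extChartAt (I := 𝓡 n) hx').hasMFDerivAt
  rwa [← TangentBundle.continuousLinearMapAt_trivializationAt hx'] at h

theorem hasMFDerivAt_extChartAt_symm_chartDiffSymm (hx : x ∈ (extChartAt (𝓡 n) c).source) :
    HasMFDerivAt 𝓘(ℝ, EuclideanSpace ℝ (Fin n)) (𝓡 n) (extChartAt (𝓡 n) c).symm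
      (extChartAt (𝓡 n) c x) (chartDiffSymm c ((extChartAt (𝓡 n) c).symm (extChartAt (𝓡 n) c x))) := by
  have hx' : x ∈ (chartAt (EuclideanSpace ℝ (Fin n)) c).source := by simpa using hx
  have h := (mdifferentiableWithinAt_extChartAt_symm (I := 𝓡 n)
    ((extChartAt (𝓡 n) c).map_source hx)).hasMFDerivWithinAt
  rw [← TangentBundle.symmL_trivializationAt hx'] at h
  have h2 : (extChartAt (𝓡 n) c).symm (extChartAt (𝓡 n) c x) = x :=
    (extChartAt (𝓡 n) c).left_inv hx
  rw [ModelWithCorners.range_eq_univ] at h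
  rw [h2]
  exact hasMFDerivWithinAt_univ.1 h

variable (c) in
/-- The coordinate representation of a vector field in the chart at `c`. -/
def localVec (Y : Π y : M, TangentSpace (𝓡 n) y) (u : EuclideanSpace ℝ (Fin n)) :
    EuclideanSpace ℝ (Fin n) :=
  chartDiff c ((extChartAt (𝓡 n) c).symm u) (Y ((extChartAt (𝓡 n) c).symm u))

variable (c) in
/-- The coordinate representation of a `1`-form in the chart at `c`. -/
def localForm (α : OneForm n M) (u : EuclideanSpace ℝ (Fin n)) :
    EuclideanSpace ℝ (Fin n) →L[ℝ] ℝ :=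
  α ((extChartAt (𝓡 n) c).symm u) ∘L chartDiffSymm c ((extChartAt (𝓡 n) c).symm u)

variable (c) in
/-- The coordinate representation of a `(2,0)` tensor in the chart at `c`. -/
def localTensor (Θ : Tensor20 n M) (u : EuclideanSpace ℝ (Fin n)) :
    (EuclideanSpace ℝ (Fin n) →L[ℝ] ℝ) →L[ℝ] EuclideanSpace ℝ (Fin n) :=
  chartDiff c ((extChartAt (𝓡 n) c).symm u) ∘L Θ ((extChartAt (𝓡 n) c).symm u) ∘L
    ContinuousLinearMap.precomp ℝ (chartDiff c ((extChartAt (𝓡 n) c).symm u))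

theorem localVec_extChartAt (hx : x ∈ (extChartAt (𝓡 n) c).source)
    (Y : Π y : M, TangentSpace (𝓡 n) y) :
    localVec c Y (extChartAt (𝓡 n) c x) = chartDiff c x (Y x) := by
  rw [localVec, (extChartAt (𝓡 n) c).left_inv hx]

theorem localForm_extChartAt (hx : x ∈ (extChartAt (𝓡 n) c).source) (α : OneForm n M) :
    localForm c α (extChartAt (𝓡 n) c x) = α x ∘L chartDiffSymm c x := by
  rw [localForm, (extChartAt (𝓡 n) c).left_inv hx]

theorem localTensor_extChartAt (hx : x ∈ (extChartAt (𝓡 n) c).source) (Θ : Tensor20 n M)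
    (ξ : EuclideanSpace ℝ (Fin n) →L[ℝ] ℝ) :
    localTensor c Θ (extChartAt (𝓡 n) c x) ξ = chartDiff c x (Θ x (ξ ∘L chartDiff c x)) := by
  rw [localTensor, (extChartAt (𝓡 n) c).left_inv hx]
  rfl

theorem chartDiff_tensor (hx : x ∈ (extChartAt (𝓡 n) c).source) (Θ : Tensor20 n M)
    (ξ : TangentSpace (𝓡 n) x →L[ℝ] ℝ) :
    chartDiff c x (Θ x ξ) =
      localTensor c Θ (extChartAt (𝓡 n) c x) (ξ ∘L chartDiffSymm c x) := by
  rw [localTensor_extChartAt hx]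
  congr 2
  ext v
  exact congrArg ξ (chartDiffSymm_chartDiff hx v).symm

theorem snd_trivializationAt_apply (hx : x ∈ (extChartAt (𝓡 n) c).source)
    (v : TangentSpace (𝓡 n) x) :
    (trivializationAt (EuclideanSpace ℝ (Fin n)) (TangentSpace (𝓡 n)) c ⟨x, v⟩).2 =
      chartDiff c x v :=
  (congrFun (Trivialization.coe_linearMapAt_of_mem (R := ℝ) _ (mem_baseSet_of_mem_source hx)) v).symm

omit [IsManifold (𝓡 n) ∞ M] in
theorem mem_extChartAt_source_nhds (hx : x ∈ (extChartAt (𝓡 n) c).source) :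
    (extChartAt (𝓡 n) c).source ∈ 𝓝 x :=
  (isOpen_extChartAt_source c).mem_nhds hx

section Functions

variable {V : Type*} [NormedAddCommGroup V] [NormedSpace ℝ V] {F : M → V}

theorem mdifferentiableAt_iff_comp_extChartAt_symm (hx : x ∈ (extChartAt (𝓡 n) c).source) :
    MDifferentiableAt (𝓡 n) 𝓘(ℝ, V) F x ↔
      DifferentiableAt ℝ (F ∘ (extChartAt (𝓡 n) c).symm) (extChartAt (𝓡 n) c x) := by
  have hinv := (extChartAt (𝓡 n) c).left_inv hx
  rw [← mdifferentiableAt_iff_differentiableAt]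
  constructor
  · intro h
    rw [← hinv] at h
    exact h.comp _ (hasMFDerivAt_extChartAt_symm_chartDiffSymm hx).mdifferentiableAt
  · intro h
    have h1 := h.comp x (hasMFDerivAt_extChartAt_chartDiff hx).mdifferentiableAt
    refine h1.congr_of_eventuallyEq ?_
    filter_upwards [mem_extChartAt_source_nhds hx] with y hy
    simp only [Function.comp_apply, (extChartAt (𝓡 n) c).left_inv hy]

theorem mvfderiv_eq_fderiv_comp (hx : x ∈ (extChartAt (𝓡 n) c).source)
    (hF : MDifferentiableAt (𝓡 n) 𝓘(ℝ, V) F x) (v : TangentSpace (𝓡 n) x) :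
    mvfderiv (𝓡 n) F x v =
      fderiv ℝ (F ∘ (extChartAt (𝓡 n) c).symm) (extChartAt (𝓡 n) c x) (chartDiff c x v) := by
  have h1 := ((mdifferentiableAt_iff_comp_extChartAt_symm hx).1 hF).hasFDerivAt.hasMFDerivAt
  have h2 := h1.comp x (hasMFDerivAt_extChartAt_chartDiff hx)
  have h3 : F =ᶠ[𝓝 x] (F ∘ (extChartAt (𝓡 n) c).symm) ∘ extChartAt (𝓡 n) c := by
    filter_upwards [mem_extChartAt_source_nhds hx] with y hy
    simp only [Function.comp_apply, (extChartAt (𝓡 n) c).left_inv hy]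
  have h4 := (h2.congr_of_eventuallyEq h3).mfderiv
  simp only [mvfderiv]
  rw [h4]
  rfl

theorem contDiffOn_comp_extChartAt_symm
    (hF : ContMDiffOn (𝓡 n) 𝓘(ℝ, V) ∞ F (extChartAt (𝓡 n) c).source) :
    ContDiffOn ℝ ∞ (F ∘ (extChartAt (𝓡 n) c).symm) (extChartAt (𝓡 n) c).target := by
  rw [← contMDiffOn_iff_contDiffOn]
  exact hF.comp (contMDiffOn_extChartAt_symm c) (extChartAt (𝓡 n) c).mapsTo_symm

end Functions

section Sections

theorem mdifferentiableAt_vec_iff (hx : x ∈ (extChartAt (𝓡 n) c).source)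
    {Y : Π y : M, TangentSpace (𝓡 n) y} :
    MDifferentiableAt (𝓡 n) ((𝓡 n).prod 𝓘(ℝ, EuclideanSpace ℝ (Fin n)))
      (fun y ↦ TotalSpace.mk' (EuclideanSpace ℝ (Fin n)) y (Y y)) x ↔
    DifferentiableAt ℝ (localVec c Y) (extChartAt (𝓡 n) c x) := by
  rw [Trivialization.mdifferentiableAt_section_iff (IB := 𝓡 n) (e := trivializationAt
    (EuclideanSpace ℝ (Fin n)) (TangentSpace (𝓡 n)) c) _ (mem_baseSet_of_mem_source hx),
    mdifferentiableAt_iff_comp_extChartAt_symm hx]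
  refine Filter.EventuallyEq.differentiableAt_iff ?_
  filter_upwards [extChartAt_target_mem_nhds' ((extChartAt (𝓡 n) c).map_source hx)] with u hu
  exact snd_trivializationAt_apply ((extChartAt (𝓡 n) c).map_target hu) _

theorem contDiffOn_localVec {Y : Π y : M, TangentSpace (𝓡 n) y}
    (hY : ContMDiff (𝓡 n) ((𝓡 n).prod 𝓘(ℝ, EuclideanSpace ℝ (Fin n))) ∞
      (fun y ↦ TotalSpace.mk' (EuclideanSpace ℝ (Fin n)) y (Y y))) :
    ContDiffOn ℝ ∞ (localVec c Y) (extChartAt (𝓡 n) c).target := by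
  have h := (Trivialization.contMDiffOn_section_iff (IB := 𝓡 n) (n := ∞) (trivializationAt
    (EuclideanSpace ℝ (Fin n)) (TangentSpace (𝓡 n)) c) (isOpen_extChartAt_source c)
    (fun x hx ↦ mem_baseSet_of_mem_source hx)).1 hY.contMDiffOn
  refine (contDiffOn_comp_extChartAt_symm h).congr fun u hu ↦ ?_
  exact (snd_trivializationAt_apply ((extChartAt (𝓡 n) c).map_target hu) _).symm

/-- The trivialization of a Hom bundle conjugates by those of source and target; here the target is
the trivial line bundle. -/
theorem snd_trivializationAt_dual_apply (α : TangentSpace (𝓡 n) x →L[ℝ] ℝ) :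
    (trivializationAt (EuclideanSpace ℝ (Fin n) →L[ℝ] ℝ)
      (fun z : M ↦ (TangentSpace (𝓡 n) z →L[ℝ] ℝ)) c ⟨x, α⟩).2 = α ∘L chartDiffSymm c x := by
  ext v
  have h := DFunLike.congr_fun (Trivial.continuousLinearMapAt_trivialization ℝ M ℝ x)
    (α (chartDiffSymm c x v))
  exact h

theorem symmL_trivializationAt_dual (hx : x ∈ (extChartAt (𝓡 n) c).source)
    (ξ : EuclideanSpace ℝ (Fin n) →L[ℝ] ℝ) :
    Trivialization.symmL ℝ (trivializationAt (EuclideanSpace ℝ (Fin n) →L[ℝ] ℝ)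
      (fun z : M ↦ (TangentSpace (𝓡 n) z →L[ℝ] ℝ)) c) x ξ = ξ ∘L chartDiff c x := by
  have hx' : x ∈ (trivializationAt (EuclideanSpace ℝ (Fin n) →L[ℝ] ℝ)
      (fun z : M ↦ (TangentSpace (𝓡 n) z →L[ℝ] ℝ)) c).baseSet :=
    ⟨mem_baseSet_of_mem_source hx, trivial⟩
  have h1 := Trivialization.symmL_continuousLinearMapAt (R := ℝ) _ hx' (ξ ∘L chartDiff c x)
  have h2 : Trivialization.continuousLinearMapAt ℝ (trivializationAt
      (EuclideanSpace ℝ (Fin n) →L[ℝ] ℝ) (fun z : M ↦ (TangentSpace (𝓡 n) z →L[ℝ] ℝ)) c) x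
      (ξ ∘L chartDiff c x) = ξ := by
    refine (congrFun (Trivialization.coe_linearMapAt_of_mem (R := ℝ) _ hx') _).trans ?_
    refine (snd_trivializationAt_dual_apply _).trans ?_
    ext v
    exact congrArg ξ (chartDiff_chartDiffSymm hx v)
  rwa [h2] at h1

theorem oneForm_differentiableAt_iff (hx : x ∈ (extChartAt (𝓡 n) c).source) {α : OneForm n M} :
    α.DifferentiableAt x ↔ DifferentiableAt ℝ (localForm c α) (extChartAt (𝓡 n) c x) := by
  rw [OneForm.DifferentiableAt,
    Trivialization.mdifferentiableAt_section_iff (IB := 𝓡 n) (e := trivializationAt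
      (EuclideanSpace ℝ (Fin n) →L[ℝ] ℝ) (fun z : M ↦ (TangentSpace (𝓡 n) z →L[ℝ] ℝ)) c) _
      ⟨mem_baseSet_of_mem_source hx, trivial⟩,
    mdifferentiableAt_iff_comp_extChartAt_symm hx]
  refine Filter.EventuallyEq.differentiableAt_iff ?_
  filter_upwards [extChartAt_target_mem_nhds' ((extChartAt (𝓡 n) c).map_source hx)] with u hu
  exact snd_trivializationAt_dual_apply _

theorem contDiffOn_localTensor {Θ : Tensor20 n M} (hΘ : Θ.IsSmooth) :
    ContDiffOn ℝ ∞ (localTensor c Θ) (extChartAt (𝓡 n) c).target := by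
  have h := (Trivialization.contMDiffOn_section_iff (IB := 𝓡 n) (n := ∞) (trivializationAt
    ((EuclideanSpace ℝ (Fin n) →L[ℝ] ℝ) →L[ℝ] EuclideanSpace ℝ (Fin n))
    (fun z : M ↦ ((TangentSpace (𝓡 n) z →L[ℝ] ℝ) →L[ℝ] TangentSpace (𝓡 n) z)) c)
    (isOpen_extChartAt_source c)
    (fun x hx ↦ ⟨⟨mem_baseSet_of_mem_source hx, trivial⟩, mem_baseSet_of_mem_source hx⟩)).1
    hΘ.contMDiffOn
  refine (contDiffOn_comp_extChartAt_symm h).congr fun u hu ↦ ?_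
  ext1 ξ
  change chartDiff c _ (Θ _ (ξ ∘L chartDiff c _)) = chartDiff c _ (Θ _
    (Trivialization.symmL ℝ (trivializationAt (EuclideanSpace ℝ (Fin n) →L[ℝ] ℝ)
      (fun z : M ↦ (TangentSpace (𝓡 n) z →L[ℝ] ℝ)) c) _ ξ))
  rw [symmL_trivializationAt_dual ((extChartAt (𝓡 n) c).map_target hu)]

end Sections

end Charts

/-! ### The Lie bracket in coordinates. -/

section Brackets

open Set Topology

variable {n : ℕ} {M : Type*} [TopologicalSpace M] [ChartedSpace (EuclideanSpace ℝ (Fin n)) M]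
  [IsManifold (𝓡 n) ∞ M] {c x : M}

/-- Reduces the coordinate formula for the bracket to the naturality of brackets under pullback. -/
theorem mpullback_extChartAt_symm {u : EuclideanSpace ℝ (Fin n)}
    (hu : u ∈ (extChartAt (𝓡 n) c).target) (Y : Π y : M, TangentSpace (𝓡 n) y) :
    VectorField.mpullback 𝓘(ℝ, EuclideanSpace ℝ (Fin n)) (𝓡 n) (extChartAt (𝓡 n) c).symm Y u =
      localVec c Y u := by
  have hx := (extChartAt (𝓡 n) c).map_target hu
  have h := hasMFDerivAt_extChartAt_symm_chartDiffSymm hx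
  rw [(extChartAt (𝓡 n) c).right_inv hu] at h
  have h2 : (mfderiv 𝓘(ℝ, EuclideanSpace ℝ (Fin n)) (𝓡 n) (extChartAt (𝓡 n) c).symm u).inverse =
      chartDiff c ((extChartAt (𝓡 n) c).symm u) := by
    refine (congrArg ContinuousLinearMap.inverse h.mfderiv).trans
      (ContinuousLinearMap.inverse_eq ?_ ?_)
    · ext1 v
      exact chartDiffSymm_chartDiff hx v
    · ext1 v
      exact chartDiff_chartDiffSymm hx v
  exact DFunLike.congr_fun h2 _

theorem chartDiff_mlieBracket (hx : x ∈ (extChartAt (𝓡 n) c).source)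
    {X Y : Π y : M, TangentSpace (𝓡 n) y}
    (hX : MDifferentiableAt (𝓡 n) ((𝓡 n).prod 𝓘(ℝ, EuclideanSpace ℝ (Fin n)))
      (fun y ↦ TotalSpace.mk' (EuclideanSpace ℝ (Fin n)) y (X y)) x)
    (hY : MDifferentiableAt (𝓡 n) ((𝓡 n).prod 𝓘(ℝ, EuclideanSpace ℝ (Fin n)))
      (fun y ↦ TotalSpace.mk' (EuclideanSpace ℝ (Fin n)) y (Y y)) x) :
    chartDiff c x (VectorField.mlieBracket (𝓡 n) X Y x) =
      fderiv ℝ (localVec c Y) (extChartAt (𝓡 n) c x) (localVec c X (extChartAt (𝓡 n) c x)) -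
      fderiv ℝ (localVec c X) (extChartAt (𝓡 n) c x) (localVec c Y (extChartAt (𝓡 n) c x)) := by
  have hu := (extChartAt (𝓡 n) c).map_source hx
  have hinv := (extChartAt (𝓡 n) c).left_inv hx
  have hT := extChartAt_target_mem_nhds' (I := 𝓡 n) hu
  have h2 : minSmoothness ℝ 2 ≤ ∞ :=
    minSmoothness_of_isRCLikeNormedField.le.trans (WithTop.coe_le_coe.2 (le_top : (2 : ℕ∞) ≤ ⊤))
  have : IsManifold (𝓡 n) (minSmoothness ℝ 3) M := IsManifold.of_le (n := ∞)
    (minSmoothness_of_isRCLikeNormedField.le.trans (WithTop.coe_le_coe.2 (le_top : (3 : ℕ∞) ≤ ⊤)))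
  have : IsManifold (𝓡 n) (minSmoothness ℝ 2) M := IsManifold.of_le (n := ∞) h2
  have key := VectorField.mpullback_mlieBracket (I := 𝓘(ℝ, EuclideanSpace ℝ (Fin n))) (I' := 𝓡 n)
    (f := (extChartAt (𝓡 n) c).symm) (V := X) (W := Y) (x₀ := extChartAt (𝓡 n) c x) (n := ∞)
    (by rwa [hinv]) (by rwa [hinv]) ((contMDiffOn_extChartAt_symm c).contMDiffAt hT)
    h2
  rw [mpullback_extChartAt_symm hu, localVec_extChartAt hx] at key
  have h3 := Filter.EventuallyEq.mlieBracket_vectorField_eq (I := 𝓘(ℝ, EuclideanSpace ℝ (Fin n)))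
    (Filter.mem_of_superset hT fun u hu ↦ mpullback_extChartAt_symm hu X)
    (Filter.mem_of_superset hT fun u hu ↦ mpullback_extChartAt_symm hu Y)
  have h4 : VectorField.mlieBracket 𝓘(ℝ, EuclideanSpace ℝ (Fin n)) (localVec c X) (localVec c Y) =
      VectorField.lieBracket ℝ (localVec c X) (localVec c Y) :=
    VectorField.mlieBracketWithin_univ.symm.trans
      (VectorField.mlieBracketWithin_eq_lieBracketWithin.trans VectorField.lieBracketWithin_univ)
  exact key.trans (h3.trans (congrFun h4 _))

end Brackets

/-! ### From a parallelizing connection to integral manifolds. -/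

section IntegralManifolds

open Set Topology Module

variable {n : ℕ} {M : Type*} [TopologicalSpace M] [ChartedSpace (EuclideanSpace ℝ (Fin n)) M]
  [IsManifold (𝓡 n) ∞ M] {c x : M} {Θ : Tensor20 n M}

theorem range_localTensor (hx : x ∈ (extChartAt (𝓡 n) c).source) :
    (localTensor c Θ (extChartAt (𝓡 n) c x) :
      (EuclideanSpace ℝ (Fin n) →L[ℝ] ℝ) →ₗ[ℝ] EuclideanSpace ℝ (Fin n)).range =
    (Θ.image x).map (chartDiff (n := n) c x : TangentSpace (𝓡 n) x →ₗ[ℝ] EuclideanSpace ℝ (Fin n)) := by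
  ext w
  constructor
  · rintro ⟨ξ, rfl⟩
    exact ⟨_, ⟨ξ ∘L chartDiff c x, rfl⟩, (localTensor_extChartAt hx Θ ξ).symm⟩
  · rintro ⟨_, ⟨ξ, rfl⟩, rfl⟩
    exact ⟨ξ ∘L chartDiffSymm c x, (chartDiff_tensor hx Θ ξ).symm⟩

theorem chartDiff_injective (hx : x ∈ (extChartAt (𝓡 n) c).source) :
    Function.Injective (chartDiff (n := n) c x) :=
  Function.LeftInverse.injective (chartDiffSymm_chartDiff hx)

theorem chartDiffSymm_injective (hx : x ∈ (extChartAt (𝓡 n) c).source) :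
    Function.Injective (chartDiffSymm (n := n) c x) :=
  Function.LeftInverse.injective (chartDiff_chartDiffSymm hx)

theorem map_chartDiffSymm_range_localTensor (hx : x ∈ (extChartAt (𝓡 n) c).source) :
    ((localTensor c Θ (extChartAt (𝓡 n) c x) :
      (EuclideanSpace ℝ (Fin n) →L[ℝ] ℝ) →ₗ[ℝ] EuclideanSpace ℝ (Fin n)).range).map
      (chartDiffSymm (n := n) c x : EuclideanSpace ℝ (Fin n) →ₗ[ℝ] TangentSpace (𝓡 n) x) = Θ.image x := by
  rw [range_localTensor hx, ← Submodule.map_comp]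
  have h : (chartDiffSymm (n := n) c x : EuclideanSpace ℝ (Fin n) →ₗ[ℝ] TangentSpace (𝓡 n) x) ∘ₗ
      (chartDiff (n := n) c x : TangentSpace (𝓡 n) x →ₗ[ℝ] EuclideanSpace ℝ (Fin n)) = LinearMap.id :=
    LinearMap.ext (chartDiffSymm_chartDiff hx)
  exact (congrArg (fun f ↦ (Θ.image x).map f) h).trans (Submodule.map_id _)

theorem finrank_range_localTensor (hx : x ∈ (extChartAt (𝓡 n) c).source) :
    finrank ℝ (localTensor c Θ (extChartAt (𝓡 n) c x) :
      (EuclideanSpace ℝ (Fin n) →L[ℝ] ℝ) →ₗ[ℝ] EuclideanSpace ℝ (Fin n)).range =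
    finrank ℝ (Θ.image x) := by
  rw [range_localTensor hx]
  exact (Submodule.equivMapOfInjective _ (chartDiff_injective hx) _).finrank_eq.symm

theorem localTensor_symm (hsymm : Θ.IsSymmetric) {u : EuclideanSpace ℝ (Fin n)}
    (ξ η : EuclideanSpace ℝ (Fin n) →L[ℝ] ℝ) :
    η (localTensor c Θ u ξ) = ξ (localTensor c Θ u η) :=
  hsymm _ (ξ ∘L chartDiff c _) (η ∘L chartDiff c _)

theorem exists_isGeneralizedInverseOn_localTensor (hsmooth : Θ.IsSmooth) (hsymm : Θ.IsSymmetric)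
    (hrank : Θ.HasConstantRank) (c : M) :
    ∃ G s, s ⊆ (extChartAt (𝓡 n) c).target ∧ extChartAt (𝓡 n) c c ∈ s ∧
      IsGeneralizedInverseOn (localTensor c Θ) G s := by
  obtain ⟨r, hr⟩ := hrank
  refine exists_isGeneralizedInverseOn (r := r) (isOpen_extChartAt_target c)
    (contDiffOn_localTensor hsmooth) (fun u _ ξ η ↦ localTensor_symm hsymm ξ η) (fun u hu ↦ ?_)
    (mem_extChartAt_target c)
  have hx := (extChartAt (𝓡 n) c).map_target hu
  have h := finrank_range_localTensor (Θ := Θ) hx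
  rw [(extChartAt (𝓡 n) c).right_inv hu] at h
  exact h.trans (hr _)

theorem localForm_comp_chartDiff (ξ : EuclideanSpace ℝ (Fin n) →L[ℝ] ℝ)
    {u : EuclideanSpace ℝ (Fin n)} (hu : u ∈ (extChartAt (𝓡 n) c).target) :
    localForm c (fun y : M ↦ ξ ∘L chartDiff c y) u = ξ := by
  ext v
  exact congrArg ξ (chartDiff_chartDiffSymm ((extChartAt (𝓡 n) c).map_target hu) v)

theorem differentiableAt_comp_chartDiff (hx : x ∈ (extChartAt (𝓡 n) c).source)
    (ξ : EuclideanSpace ℝ (Fin n) →L[ℝ] ℝ) :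
    OneForm.DifferentiableAt (n := n) (fun y : M ↦ ξ ∘L chartDiff c y) x := by
  rw [oneForm_differentiableAt_iff hx]
  refine (differentiableAt_const ξ).congr_of_eventuallyEq ?_
  filter_upwards [extChartAt_target_mem_nhds' (I := 𝓡 n) ((extChartAt (𝓡 n) c).map_source hx)]
    with u hu using localForm_comp_chartDiff ξ hu

theorem differentiableAt_localTensor (hsmooth : Θ.IsSmooth)
    (hx : x ∈ (extChartAt (𝓡 n) c).source) :
    DifferentiableAt ℝ (localTensor c Θ) (extChartAt (𝓡 n) c x) :=
  ((contDiffOn_localTensor hsmooth).contDiffAt (extChartAt_target_mem_nhds' (I := 𝓡 n)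
    ((extChartAt (𝓡 n) c).map_source hx))).differentiableAt (by simp)

/-- For the forms with constant coefficients ξ, η in the chart, zero torsion and ∇Θ = 0 give [Θξ,
Θη] = Θ(∇_{Θξ} η - ∇_{Θη} ξ); this is that identity in coordinates. -/
theorem exists_bracket_localTensor_eq (hsmooth : Θ.IsSmooth) (cov : Connection n M)
    (htorsion : cov.torsion = 0) (hpar : Θ.IsParallel cov)
    (hx : x ∈ (extChartAt (𝓡 n) c).source) (ξ η : EuclideanSpace ℝ (Fin n) →L[ℝ] ℝ) :
    ∃ ζ, fderiv ℝ (localTensor c Θ) (extChartAt (𝓡 n) c x)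
        (localTensor c Θ (extChartAt (𝓡 n) c x) ξ) η -
      fderiv ℝ (localTensor c Θ) (extChartAt (𝓡 n) c x)
        (localTensor c Θ (extChartAt (𝓡 n) c x) η) ξ =
      localTensor c Θ (extChartAt (𝓡 n) c x) ζ := by
  have hd := differentiableAt_localTensor hsmooth hx
  have hdiff (ζ : EuclideanSpace ℝ (Fin n) →L[ℝ] ℝ) :
      MDifferentiableAt (𝓡 n) ((𝓡 n).prod 𝓘(ℝ, EuclideanSpace ℝ (Fin n)))
        (fun y ↦ TotalSpace.mk' (EuclideanSpace ℝ (Fin n)) y (Θ y (ζ ∘L chartDiff c y))) x :=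
    (mdifferentiableAt_vec_iff hx).2 (hd.clm_apply (differentiableAt_const ζ))
  have hfderiv (ζ : EuclideanSpace ℝ (Fin n) →L[ℝ] ℝ) (v : EuclideanSpace ℝ (Fin n)) :
      fderiv ℝ (localVec c fun y ↦ Θ y (ζ ∘L chartDiff c y)) (extChartAt (𝓡 n) c x) v =
        fderiv ℝ (localTensor c Θ) (extChartAt (𝓡 n) c x) v ζ :=
    DFunLike.congr_fun ((((ContinuousLinearMap.apply ℝ (EuclideanSpace ℝ (Fin n)) ζ).hasFDerivAt).comp
      (extChartAt (𝓡 n) c x) hd.hasFDerivAt).fderiv) v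
  have hbr := chartDiff_mlieBracket hx (hdiff ξ) (hdiff η)
  have htor := cov.torsion_eq_zero_iff.1 htorsion (hdiff ξ) (hdiff η)
  rw [hpar x _ (differentiableAt_comp_chartDiff hx η), hpar x _ (differentiableAt_comp_chartDiff hx ξ),
    ← map_sub] at htor
  rw [hfderiv, hfderiv, ← htor, chartDiff_tensor hx] at hbr
  exact ⟨_, hbr.symm⟩

theorem isIntegrableDistribution_of_isIntegrable (hsmooth : Θ.IsSmooth) (hsymm : Θ.IsSymmetric)
    (hrank : Θ.HasConstantRank) (h : Θ.IsIntegrable) : IsIntegrableDistribution Θ.image := by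
  obtain ⟨cov, -, htorsion, hpar⟩ := h
  intro p
  obtain ⟨G, s, hst, hps, hG⟩ := exists_isGeneralizedInverseOn_localTensor hsmooth hsymm hrank p
  have hinv : ∀ u ∈ s, IsGeneralizedInverseOn.IsInvolutiveAt (localTensor p Θ) G u := by
    intro u hu
    refine hG.isInvolutiveAt_of_bracket hu fun ξ η ↦ ?_
    have hx := (extChartAt (𝓡 n) p).map_target (hst hu)
    have hb := exists_bracket_localTensor_eq hsmooth cov htorsion hpar hx ξ η
    rwa [(extChartAt (𝓡 n) p).right_inv (hst hu)] at hb
  obtain ⟨k, U, f, hU, hf, hfinj, hfs, ⟨a, ha, hfa⟩, hfder⟩ := hG.exists_integralManifold hinv hps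
  refine ⟨k, U, (extChartAt (𝓡 n) p).symm ∘ f, hU, ?_, ?_, ⟨a, ha, ?_⟩, fun b hb ↦ ?_⟩
  · exact (contMDiffOn_extChartAt_symm p).comp (contMDiffOn_iff_contDiffOn.2 hf)
      fun b hb ↦ hst (hfs hb)
  · exact (extChartAt (𝓡 n) p).symm.injOn.comp hfinj fun b hb ↦ hst (hfs hb)
  · rw [Function.comp_apply, hfa, extChartAt_to_inv]
  · have hbt := hst (hfs hb)
    have hx := (extChartAt (𝓡 n) p).map_target hbt
    have h1 := hasMFDerivAt_extChartAt_symm_chartDiffSymm hx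
    rw [(extChartAt (𝓡 n) p).right_inv hbt] at h1
    have h2 : HasMFDerivAt 𝓘(ℝ, EuclideanSpace ℝ (Fin k)) 𝓘(ℝ, EuclideanSpace ℝ (Fin n)) f b
        (fderiv ℝ f b) :=
      (((hf.contDiffAt (hU.mem_nhds hb)).differentiableAt (by simp)).hasFDerivAt).hasMFDerivAt
    have h3 := (h1.comp b h2).mfderiv
    have h4 := map_chartDiffSymm_range_localTensor (Θ := Θ) hx
    rw [(extChartAt (𝓡 n) p).right_inv hbt, ← (hfder b hb).2] at h4
    rw [h3]
    refine ⟨(chartDiffSymm_injective hx).comp (hfder b hb).1, ?_⟩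
    refine Eq.trans ?_ h4
    exact LinearMap.range_comp _ _

end IntegralManifolds

/-! ### From integral manifolds to connections in a chart. -/

section LocalConnections

open Set Topology Module

variable {n : ℕ} {M : Type*} [TopologicalSpace M] [ChartedSpace (EuclideanSpace ℝ (Fin n)) M]
  [IsManifold (𝓡 n) ∞ M] {c x : M} {Θ : Tensor20 n M}

theorem isInvolutiveAt_localTensor
    {G : EuclideanSpace ℝ (Fin n) → EuclideanSpace ℝ (Fin n) →L[ℝ] EuclideanSpace ℝ (Fin n) →L[ℝ] ℝ}
    {s : Set (EuclideanSpace ℝ (Fin n))} (hG : IsGeneralizedInverseOn (localTensor c Θ) G s)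
    (hst : s ⊆ (extChartAt (𝓡 n) c).target) (hint : IsIntegrableDistribution Θ.image)
    {u : EuclideanSpace ℝ (Fin n)} (hu : u ∈ s) :
    IsGeneralizedInverseOn.IsInvolutiveAt (localTensor c Θ) G u := by
  obtain ⟨k, U, f, hU, hf, -, ⟨a, ha, hfa⟩, hfder⟩ := hint ((extChartAt (𝓡 n) c).symm u)
  have hinv : (extChartAt (𝓡 n) c ∘ f) a = u := by
    rw [Function.comp_apply, hfa, (extChartAt (𝓡 n) c).right_inv (hst hu)]
  have hsrc : f a ∈ (extChartAt (𝓡 n) c).source :=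
    hfa ▸ (extChartAt (𝓡 n) c).map_target (hst hu)
  have hfat := hf.contMDiffAt (hU.mem_nhds ha)
  rw [← hinv]
  refine hG.isInvolutiveAt_of_integralManifold (g := extChartAt (𝓡 n) c ∘ f) ?_ (hinv ▸ hu) ?_
  · rw [← contMDiffAt_iff_contDiffAt]
    refine ContMDiffAt.comp a ?_ hfat
    exact (contMDiffOn_extChartAt (I := 𝓡 n) (n := ∞) (x := c)).contMDiffAt
      ((chartAt _ c).open_source.mem_nhds (by simpa using hsrc))
  · filter_upwards [hU.mem_nhds ha,
      hfat.continuousAt.preimage_mem_nhds (mem_extChartAt_source_nhds hsrc)] with b hb hbsrc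
    have h1 := ((hf.contMDiffAt (hU.mem_nhds hb)).mdifferentiableAt (by simp)).hasMFDerivAt
    let D : EuclideanSpace ℝ (Fin k) →L[ℝ] EuclideanSpace ℝ (Fin n) :=
      chartDiff c (f b) ∘L mfderiv (𝓡 k) (𝓡 n) f b
    have h2 : HasFDerivAt (extChartAt (𝓡 n) c ∘ f) D b := hasMFDerivAt_iff_hasFDerivAt.1
      ((hasMFDerivAt_extChartAt_chartDiff (mem_preimage.1 hbsrc)).comp b h1)
    have h3 := range_localTensor (Θ := Θ) (mem_preimage.1 hbsrc)
    rw [← (hfder b hb).2] at h3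
    rw [h2.fderiv]
    refine Eq.trans ?_ h3.symm
    exact LinearMap.range_comp _ _

variable (c) in
/-- The covariant derivative with the Christoffel symbols `Γ` in the chart at `c`. -/
def localCov (Γ : EuclideanSpace ℝ (Fin n) →
      EuclideanSpace ℝ (Fin n) →L[ℝ] EuclideanSpace ℝ (Fin n) →L[ℝ] EuclideanSpace ℝ (Fin n))
    (Y : Π y : M, TangentSpace (𝓡 n) y) (x : M) : TangentSpace (𝓡 n) x →L[ℝ] TangentSpace (𝓡 n) x :=
  chartDiffSymm c x ∘L (fderiv ℝ (localVec c Y) (extChartAt (𝓡 n) c x) +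
    (Γ (extChartAt (𝓡 n) c x)).flip (localVec c Y (extChartAt (𝓡 n) c x))) ∘L chartDiff c x

variable (c) in
/-- The covariant derivative of a `1`-form for the Christoffel symbols `Γ` in the chart at `c`. -/
def localDualCov (Γ : EuclideanSpace ℝ (Fin n) →
      EuclideanSpace ℝ (Fin n) →L[ℝ] EuclideanSpace ℝ (Fin n) →L[ℝ] EuclideanSpace ℝ (Fin n))
    (α : OneForm n M) (x : M) (v : TangentSpace (𝓡 n) x) : TangentSpace (𝓡 n) x →L[ℝ] ℝ :=
  (fderiv ℝ (localForm c α) (extChartAt (𝓡 n) c x) (chartDiff c x v) -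
    localForm c α (extChartAt (𝓡 n) c x) ∘L Γ (extChartAt (𝓡 n) c x) (chartDiff c x v)) ∘L
    chartDiff c x

variable {Γ : EuclideanSpace ℝ (Fin n) →
      EuclideanSpace ℝ (Fin n) →L[ℝ] EuclideanSpace ℝ (Fin n) →L[ℝ] EuclideanSpace ℝ (Fin n)}
  {X Y : Π y : M, TangentSpace (𝓡 n) y}

theorem localCov_apply (v : TangentSpace (𝓡 n) x) :
    localCov c Γ Y x v = chartDiffSymm c x
      (fderiv ℝ (localVec c Y) (extChartAt (𝓡 n) c x) (chartDiff c x v) +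
      Γ (extChartAt (𝓡 n) c x) (chartDiff c x v) (localVec c Y (extChartAt (𝓡 n) c x))) :=
  rfl

theorem localCov_add (hx : x ∈ (extChartAt (𝓡 n) c).source)
    (hX : MDifferentiableAt (𝓡 n) ((𝓡 n).prod 𝓘(ℝ, EuclideanSpace ℝ (Fin n)))
      (fun y ↦ TotalSpace.mk' (EuclideanSpace ℝ (Fin n)) y (X y)) x)
    (hY : MDifferentiableAt (𝓡 n) ((𝓡 n).prod 𝓘(ℝ, EuclideanSpace ℝ (Fin n)))
      (fun y ↦ TotalSpace.mk' (EuclideanSpace ℝ (Fin n)) y (Y y)) x) :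
    localCov c Γ (X + Y) x = localCov c Γ X x + localCov c Γ Y x := by
  rw [mdifferentiableAt_vec_iff hx] at hX hY
  have h : localVec c (X + Y) = localVec c X + localVec c Y := by
    ext1 u
    exact map_add (chartDiff (n := n) c _) _ _
  ext1 v
  have h2 : (localCov c Γ X x + localCov c Γ Y x) v = localCov c Γ X x v + localCov c Γ Y x v := rfl
  rw [h2]
  apply chartDiff_injective hx
  rw [map_add, localCov_apply, localCov_apply, localCov_apply, chartDiff_chartDiffSymm hx,
    chartDiff_chartDiffSymm hx, chartDiff_chartDiffSymm hx, h, fderiv_add hX hY]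
  simp only [Pi.add_apply, map_add, _root_.add_apply]
  abel

theorem localCov_leibniz (hx : x ∈ (extChartAt (𝓡 n) c).source)
    (hY : MDifferentiableAt (𝓡 n) ((𝓡 n).prod 𝓘(ℝ, EuclideanSpace ℝ (Fin n)))
      (fun y ↦ TotalSpace.mk' (EuclideanSpace ℝ (Fin n)) y (Y y)) x)
    {g : M → ℝ} (hg : MDifferentiableAt (𝓡 n) 𝓘(ℝ, ℝ) g x) :
    localCov c Γ (g • Y) x = g x • localCov c Γ Y x + (mvfderiv (𝓡 n) g x).smulRight (Y x) := by
  have hinv := (extChartAt (𝓡 n) c).left_inv hx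
  rw [mdifferentiableAt_vec_iff hx] at hY
  have hg' := (mdifferentiableAt_iff_comp_extChartAt_symm hx).1 hg
  have h : localVec c (g • Y) = fun u ↦ (g ∘ (extChartAt (𝓡 n) c).symm) u • localVec c Y u := by
    ext1 u
    exact map_smul (chartDiff (n := n) c _) _ _
  ext1 v
  have h2 : (g x • localCov c Γ Y x + (mvfderiv (𝓡 n) g x).smulRight (Y x)) v =
      g x • localCov c Γ Y x v + mvfderiv (𝓡 n) g x v • Y x := rfl
  rw [h2]
  apply chartDiff_injective hx
  rw [map_add, map_smul, map_smul, localCov_apply, localCov_apply, chartDiff_chartDiffSymm hx,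
    chartDiff_chartDiffSymm hx, h, fderiv_fun_smul hg' hY, mvfderiv_eq_fderiv_comp hx hg,
    ← localVec_extChartAt hx Y]
  simp only [Function.comp_apply, hinv, map_smul, _root_.add_apply, _root_.smul_apply,
    ContinuousLinearMap.smulRight_apply, smul_add]
  abel

/-- Symmetric Christoffel terms cancel, leaving the coordinate expression of the bracket. -/
theorem localCov_sub_localCov (hx : x ∈ (extChartAt (𝓡 n) c).source)
    (hΓ : ∀ v w, Γ (extChartAt (𝓡 n) c x) v w = Γ (extChartAt (𝓡 n) c x) w v)
    (hX : MDifferentiableAt (𝓡 n) ((𝓡 n).prod 𝓘(ℝ, EuclideanSpace ℝ (Fin n)))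
      (fun y ↦ TotalSpace.mk' (EuclideanSpace ℝ (Fin n)) y (X y)) x)
    (hY : MDifferentiableAt (𝓡 n) ((𝓡 n).prod 𝓘(ℝ, EuclideanSpace ℝ (Fin n)))
      (fun y ↦ TotalSpace.mk' (EuclideanSpace ℝ (Fin n)) y (Y y)) x) :
    localCov c Γ Y x (X x) - localCov c Γ X x (Y x) = VectorField.mlieBracket (𝓡 n) X Y x := by
  apply chartDiff_injective hx
  rw [map_sub, chartDiff_mlieBracket hx hX hY, localCov_apply, localCov_apply,
    chartDiff_chartDiffSymm hx, chartDiff_chartDiffSymm hx, ← localVec_extChartAt hx X,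
    ← localVec_extChartAt hx Y, hΓ (localVec c X (extChartAt (𝓡 n) c x))]
  abel

theorem localDualCov_apply (hx : x ∈ (extChartAt (𝓡 n) c).source) {α : OneForm n M}
    (hα : α.DifferentiableAt x)
    (hY : MDifferentiableAt (𝓡 n) ((𝓡 n).prod 𝓘(ℝ, EuclideanSpace ℝ (Fin n)))
      (fun y ↦ TotalSpace.mk' (EuclideanSpace ℝ (Fin n)) y (Y y)) x) (v : TangentSpace (𝓡 n) x) :
    localDualCov c Γ α x v (Y x) =
      mvfderiv (𝓡 n) (fun y ↦ α y (Y y)) x v - α x (localCov c Γ Y x v) := by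
  rw [mvfderiv_eq_fderiv_comp hx (hα.apply hY)]
  rw [oneForm_differentiableAt_iff hx] at hα
  rw [mdifferentiableAt_vec_iff hx] at hY
  have h : (fun y ↦ α y (Y y)) ∘ (extChartAt (𝓡 n) c).symm =ᶠ[𝓝 (extChartAt (𝓡 n) c x)]
      fun u ↦ localForm c α u (localVec c Y u) := by
    filter_upwards [extChartAt_target_mem_nhds' (I := 𝓡 n) ((extChartAt (𝓡 n) c).map_source hx)]
      with u hu
    exact congrArg (α _) (chartDiffSymm_chartDiff ((extChartAt (𝓡 n) c).map_target hu) _).symm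
  have h2 : α x (localCov c Γ Y x v) = localForm c α (extChartAt (𝓡 n) c x)
      (fderiv ℝ (localVec c Y) (extChartAt (𝓡 n) c x) (chartDiff c x v) +
      Γ (extChartAt (𝓡 n) c x) (chartDiff c x v) (localVec c Y (extChartAt (𝓡 n) c x))) := by
    rw [localForm_extChartAt hx]
    rfl
  have h3 : localDualCov c Γ α x v (Y x) =
      fderiv ℝ (localForm c α) (extChartAt (𝓡 n) c x) (chartDiff c x v) (chartDiff c x (Y x)) -
      localForm c α (extChartAt (𝓡 n) c x)
        (Γ (extChartAt (𝓡 n) c x) (chartDiff c x v) (chartDiff c x (Y x))) := rfl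
  rw [h3, h.fderiv_eq, fderiv_clm_apply hα hY, h2, localVec_extChartAt hx Y, map_add]
  simp only [_root_.add_apply, ContinuousLinearMap.comp_apply, ContinuousLinearMap.flip_apply]
  abel

/-- The hypothesis `hΓ` is ∇Θ = 0 in coordinates; the product rule for Θ applied to α does the rest.
-/
theorem localCov_tensor (hsmooth : Θ.IsSmooth) (hx : x ∈ (extChartAt (𝓡 n) c).source)
    (hΓ : ∀ X ξ, fderiv ℝ (localTensor c Θ) (extChartAt (𝓡 n) c x) X ξ +
      Γ (extChartAt (𝓡 n) c x) X (localTensor c Θ (extChartAt (𝓡 n) c x) ξ) +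
      localTensor c Θ (extChartAt (𝓡 n) c x) (ξ ∘L Γ (extChartAt (𝓡 n) c x) X) = 0)
    {α : OneForm n M} (hα : α.DifferentiableAt x) (v : TangentSpace (𝓡 n) x) :
    localCov c Γ (fun y ↦ Θ y (α y)) x v = Θ x (localDualCov c Γ α x v) := by
  have hΘ := differentiableAt_localTensor hsmooth hx
  rw [oneForm_differentiableAt_iff hx] at hα
  have h : localVec c (fun y ↦ Θ y (α y)) =ᶠ[𝓝 (extChartAt (𝓡 n) c x)]
      fun u ↦ localTensor c Θ u (localForm c α u) := by
    filter_upwards [extChartAt_target_mem_nhds' (I := 𝓡 n) ((extChartAt (𝓡 n) c).map_source hx)]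
      with u hu
    have h := chartDiff_tensor ((extChartAt (𝓡 n) c).map_target hu) Θ (α _)
    rwa [(extChartAt (𝓡 n) c).right_inv hu] at h
  apply chartDiff_injective hx
  rw [localCov_apply, chartDiff_chartDiffSymm hx, h.fderiv_eq, h.eq_of_nhds,
    fderiv_clm_apply hΘ hα, localDualCov, ← localTensor_extChartAt hx, map_sub, sub_eq_add_neg,
    ← eq_neg_of_add_eq_zero_left (hΓ (chartDiff c x v) (localForm c α (extChartAt (𝓡 n) c x)))]
  simp only [_root_.add_apply, ContinuousLinearMap.comp_apply, ContinuousLinearMap.flip_apply]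
  abel

theorem contMDiffOn_localCov {s : Set (EuclideanSpace ℝ (Fin n))} (hs : IsOpen s)
    (hst : s ⊆ (extChartAt (𝓡 n) c).target) (hΓ : ContDiffOn ℝ ∞ Γ s)
    (hY : ContMDiff (𝓡 n) ((𝓡 n).prod 𝓘(ℝ, EuclideanSpace ℝ (Fin n))) ∞
      (fun y ↦ TotalSpace.mk' (EuclideanSpace ℝ (Fin n)) y (Y y))) :
    ContMDiffOn (𝓡 n) ((𝓡 n).prod 𝓘(ℝ, EuclideanSpace ℝ (Fin n) →L[ℝ] EuclideanSpace ℝ (Fin n))) ∞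
      (fun y ↦ TotalSpace.mk' (EuclideanSpace ℝ (Fin n) →L[ℝ] EuclideanSpace ℝ (Fin n))
        (E := fun z : M ↦ (TangentSpace (𝓡 n) z →L[ℝ] TangentSpace (𝓡 n) z)) y (localCov c Γ Y y))
      ((extChartAt (𝓡 n) c).source ∩ extChartAt (𝓡 n) c ⁻¹' s) := by
  have hYc := (contDiffOn_localVec (c := c) hY).mono hst
  have hflip : ContDiffOn ℝ ∞ (fun u ↦ (Γ u).flip) s :=
    (ContinuousLinearMap.flipₗᵢ ℝ (EuclideanSpace ℝ (Fin n)) (EuclideanSpace ℝ (Fin n))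
      (EuclideanSpace ℝ (Fin n))).contDiff.comp_contDiffOn hΓ
  have hF : ContDiffOn ℝ ∞ (fun u ↦ fderiv ℝ (localVec c Y) u + (Γ u).flip (localVec c Y u)) s :=
    (hYc.fderiv_of_isOpen hs (by simp)).add (hflip.clm_apply hYc)
  have hopen : IsOpen ((extChartAt (𝓡 n) c).source ∩ extChartAt (𝓡 n) c ⁻¹' s) :=
    isOpen_extChartAt_preimage' c hs
  rw [Trivialization.contMDiffOn_section_iff (IB := 𝓡 n) (n := ∞) (trivializationAt
    (EuclideanSpace ℝ (Fin n) →L[ℝ] EuclideanSpace ℝ (Fin n))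
    (fun z : M ↦ (TangentSpace (𝓡 n) z →L[ℝ] TangentSpace (𝓡 n) z)) c) hopen
    (fun x hx ↦ ⟨mem_baseSet_of_mem_source hx.1, mem_baseSet_of_mem_source hx.1⟩)]
  have h := (contMDiffOn_iff_contDiffOn.2 hF).comp (s := (extChartAt (𝓡 n) c).source ∩
    extChartAt (𝓡 n) c ⁻¹' s) (((contMDiffOn_extChartAt (I := 𝓡 n) (n := ∞) (x := c))).mono
      fun y hy ↦ by simpa using hy.1) fun y hy ↦ hy.2
  refine h.congr fun y hy ↦ ?_
  ext1 w
  change chartDiff c y (chartDiffSymm c y ((fderiv ℝ (localVec c Y) (extChartAt (𝓡 n) c y) +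
    (Γ (extChartAt (𝓡 n) c y)).flip (localVec c Y (extChartAt (𝓡 n) c y)))
      (chartDiff c y (chartDiffSymm c y w)))) = _
  rw [chartDiff_chartDiffSymm hy.1, chartDiff_chartDiffSymm hy.1]
  rfl

end LocalConnections

/-! ### Glueing local connections by a partition of unity. -/

section Glueing

open Set Topology Module

variable {n : ℕ} {M : Type*} [TopologicalSpace M] [ChartedSpace (EuclideanSpace ℝ (Fin n)) M]
  [IsManifold (𝓡 n) ∞ M] {Θ : Tensor20 n M}
  {Γ : M → EuclideanSpace ℝ (Fin n) →
      EuclideanSpace ℝ (Fin n) →L[ℝ] EuclideanSpace ℝ (Fin n) →L[ℝ] EuclideanSpace ℝ (Fin n)}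

variable (Γ) in
/-- The weighted sum of the covariant derivatives with the Christoffel symbols `Γ c` in the chart
at `c`, for a partition of unity. -/
def gluedCov (ρ : SmoothPartitionOfUnity M (𝓡 n) M univ) (Y : Π y : M, TangentSpace (𝓡 n) y)
    (x : M) : TangentSpace (𝓡 n) x →L[ℝ] TangentSpace (𝓡 n) x :=
  ∑ᶠ c, ρ c x • localCov c (Γ c) Y x

variable {ρ : SmoothPartitionOfUnity M (𝓡 n) M univ} {U : M → Set M}

theorem gluedCov_eq_sum (Y : Π y : M, TangentSpace (𝓡 n) y) (x : M) :
    gluedCov Γ ρ Y x = ∑ c ∈ ρ.finsupport x, ρ c x • localCov c (Γ c) Y x :=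
  (ρ.sum_finsupport_smul_eq_finsum x fun c _ ↦ localCov c (Γ c) Y x).symm

theorem gluedCov_apply (Y : Π y : M, TangentSpace (𝓡 n) y) (x : M) (v : TangentSpace (𝓡 n) x) :
    gluedCov Γ ρ Y x v = ∑ c ∈ ρ.finsupport x, ρ c x • localCov c (Γ c) Y x v := by
  rw [gluedCov_eq_sum]
  exact _root_.sum_apply _ _ _

-- Ensures that `localCov c` is only ever evaluated with nonzero weight inside the domain of the
-- chart at c, outside which its values are meaningless.
omit [IsManifold (𝓡 n) ∞ M] in
theorem mem_of_mem_finsupport (hρ : ρ.IsSubordinate U) {c x : M} (hc : c ∈ ρ.finsupport x) :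
    x ∈ U c :=
  hρ c (subset_tsupport _ ((ρ.mem_finsupport x).1 hc))

theorem isCovariantDerivativeOn_gluedCov (hρ : ρ.IsSubordinate U)
    (hU : ∀ c, U c ⊆ (extChartAt (𝓡 n) c).source) :
    IsCovariantDerivativeOn (I := 𝓡 n) (EuclideanSpace ℝ (Fin n))
      (V := (TangentSpace (𝓡 n) : M → Type _)) (gluedCov Γ ρ) univ where
  add {X Y x} hX hY _ := by
    rw [gluedCov_eq_sum, gluedCov_eq_sum, gluedCov_eq_sum, ← Finset.sum_add_distrib]
    refine Finset.sum_congr rfl fun c hc ↦ ?_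
    rw [localCov_add (hU c (mem_of_mem_finsupport hρ hc)) hX hY, smul_add]
  leibniz {Y g x} hY hg _ := by
    rw [gluedCov_eq_sum, gluedCov_eq_sum, Finset.smul_sum]
    have h : (mvfderiv (𝓡 n) g x).smulRight (Y x) =
        ∑ c ∈ ρ.finsupport x, ρ c x • (mvfderiv (𝓡 n) g x).smulRight (Y x) := by
      rw [← Finset.sum_smul, ρ.sum_finsupport x (mem_univ x), one_smul]
    rw [h, ← Finset.sum_add_distrib]
    refine Finset.sum_congr rfl fun c hc ↦ ?_
    rw [localCov_leibniz (hU c (mem_of_mem_finsupport hρ hc)) hY hg, smul_add, smul_comm]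

theorem gluedCov_sub_gluedCov (hρ : ρ.IsSubordinate U)
    (hU : ∀ c, U c ⊆ (extChartAt (𝓡 n) c).source)
    (hΓ : ∀ c, ∀ x ∈ U c, ∀ v w, Γ c (extChartAt (𝓡 n) c x) v w = Γ c (extChartAt (𝓡 n) c x) w v)
    {X Y : Π y : M, TangentSpace (𝓡 n) y} {x : M}
    (hX : MDifferentiableAt (𝓡 n) ((𝓡 n).prod 𝓘(ℝ, EuclideanSpace ℝ (Fin n)))
      (fun y ↦ TotalSpace.mk' (EuclideanSpace ℝ (Fin n)) y (X y)) x)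
    (hY : MDifferentiableAt (𝓡 n) ((𝓡 n).prod 𝓘(ℝ, EuclideanSpace ℝ (Fin n)))
      (fun y ↦ TotalSpace.mk' (EuclideanSpace ℝ (Fin n)) y (Y y)) x) :
    gluedCov Γ ρ Y x (X x) - gluedCov Γ ρ X x (Y x) = VectorField.mlieBracket (𝓡 n) X Y x := by
  rw [gluedCov_apply, gluedCov_apply, ← Finset.sum_sub_distrib]
  have h : ∀ c ∈ ρ.finsupport x, ρ c x • localCov c (Γ c) Y x (X x) -
      ρ c x • localCov c (Γ c) X x (Y x) = ρ c x • VectorField.mlieBracket (𝓡 n) X Y x := by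
    intro c hc
    have hx := mem_of_mem_finsupport hρ hc
    rw [← smul_sub, localCov_sub_localCov (hU c hx) (hΓ c x hx) hX hY]
  rw [Finset.sum_congr rfl h, ← Finset.sum_smul, ρ.sum_finsupport x (mem_univ x), one_smul]

theorem contMDiff_gluedCov {s : M → Set (EuclideanSpace ℝ (Fin n))}
    (hρ : ρ.IsSubordinate fun c ↦ (extChartAt (𝓡 n) c).source ∩ extChartAt (𝓡 n) c ⁻¹' s c)
    (hs : ∀ c, IsOpen (s c)) (hst : ∀ c, s c ⊆ (extChartAt (𝓡 n) c).target)
    (hΓ : ∀ c, ContDiffOn ℝ ∞ (Γ c) (s c)) {Y : Π y : M, TangentSpace (𝓡 n) y}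
    (hY : ContMDiff (𝓡 n) ((𝓡 n).prod 𝓘(ℝ, EuclideanSpace ℝ (Fin n))) ∞
      (fun y ↦ TotalSpace.mk' (EuclideanSpace ℝ (Fin n)) y (Y y))) :
    ContMDiff (𝓡 n) ((𝓡 n).prod 𝓘(ℝ, EuclideanSpace ℝ (Fin n) →L[ℝ] EuclideanSpace ℝ (Fin n))) ∞
      (fun y ↦ TotalSpace.mk' (EuclideanSpace ℝ (Fin n) →L[ℝ] EuclideanSpace ℝ (Fin n))
        (E := fun z : M ↦ (TangentSpace (𝓡 n) z →L[ℝ] TangentSpace (𝓡 n) z)) y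
        (gluedCov Γ ρ Y y)) := by
  refine ContMDiff.finsum_section_of_locallyFinite
    (V := fun z : M ↦ (TangentSpace (𝓡 n) z →L[ℝ] TangentSpace (𝓡 n) z))
    (t := fun c y ↦ ρ c y • localCov c (Γ c) Y y) ?_ fun c ↦ ?_
  · exact ρ.locallyFinite.subset fun c x hx ↦ left_ne_zero_of_smul hx
  · exact ContMDiffOn.smul_section_of_tsupport
      (V := fun z : M ↦ (TangentSpace (𝓡 n) z →L[ℝ] TangentSpace (𝓡 n) z)) (ρ c).contMDiff.contMDiffOn
      (isOpen_extChartAt_preimage' c (hs c)) (hρ c) (contMDiffOn_localCov (hs c) (hst c) (hΓ c) hY)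

/-- Lets covectors such as `dualDeriv` be compared through their values on differentiable fields. -/
theorem exists_mdifferentiableAt_vec_eq (x : M) (w : TangentSpace (𝓡 n) x) :
    ∃ Y : Π y : M, TangentSpace (𝓡 n) y, Y x = w ∧
      MDifferentiableAt (𝓡 n) ((𝓡 n).prod 𝓘(ℝ, EuclideanSpace ℝ (Fin n)))
        (fun y ↦ TotalSpace.mk' (EuclideanSpace ℝ (Fin n)) y (Y y)) x :=
  ⟨FiberBundle.extend (EuclideanSpace ℝ (Fin n)) w, FiberBundle.extend_apply_self _ w,
    FiberBundle.mdifferentiableAt_extend ..⟩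

theorem gluedCov_tensor (hsmooth : Θ.IsSmooth) (hρ : ρ.IsSubordinate U)
    (hU : ∀ c, U c ⊆ (extChartAt (𝓡 n) c).source)
    (hΓ : ∀ c, ∀ x ∈ U c, ∀ X ξ, fderiv ℝ (localTensor c Θ) (extChartAt (𝓡 n) c x) X ξ +
      Γ c (extChartAt (𝓡 n) c x) X (localTensor c Θ (extChartAt (𝓡 n) c x) ξ) +
      localTensor c Θ (extChartAt (𝓡 n) c x) (ξ ∘L Γ c (extChartAt (𝓡 n) c x) X) = 0)
    (cov : Connection n M) (hcov : cov.toFun = gluedCov Γ ρ) : Θ.IsParallel cov := by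
  intro x α hα v
  -- The dual connection is affine in the connection: as the weights sum to 1, the term d_v(α(Y))
  -- can be distributed over the summands.
  have hdual : dualDeriv cov hα v =
      ∑ c ∈ ρ.finsupport x, ρ c x • localDualCov c (Γ c) α x v := by
    ext w
    obtain ⟨Y, rfl, hY⟩ := exists_mdifferentiableAt_vec_eq x w
    rw [dualDeriv_apply cov hα hY, hcov, gluedCov_apply, map_sum]
    have h1 : mvfderiv (𝓡 n) (fun y ↦ α y (Y y)) x v =
        ∑ c ∈ ρ.finsupport x, ρ c x • mvfderiv (𝓡 n) (fun y ↦ α y (Y y)) x v := by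
      rw [← Finset.sum_smul, ρ.sum_finsupport x (mem_univ x), one_smul]
    have h2 : (∑ c ∈ ρ.finsupport x, ρ c x • localDualCov c (Γ c) α x v) (Y x) =
        ∑ c ∈ ρ.finsupport x, ρ c x • localDualCov c (Γ c) α x v (Y x) :=
      _root_.sum_apply _ _ _
    rw [h1, h2, ← Finset.sum_sub_distrib]
    refine Finset.sum_congr rfl fun c hc ↦ ?_
    rw [localDualCov_apply (hU c (mem_of_mem_finsupport hρ hc)) hα hY, smul_sub, map_smul]
  rw [hdual, hcov, gluedCov_apply, map_sum]
  refine Finset.sum_congr rfl fun c hc ↦ ?_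
  have hx := mem_of_mem_finsupport hρ hc
  rw [map_smul, localCov_tensor hsmooth (hU c hx) (hΓ c x hx) hα]

theorem isIntegrable_of_isIntegrableDistribution [T2Space M] [SecondCountableTopology M]
    (hsmooth : Θ.IsSmooth) (hsymm : Θ.IsSymmetric) (hrank : Θ.HasConstantRank)
    (h : IsIntegrableDistribution Θ.image) : Θ.IsIntegrable := by
  choose G s hst hs hG using exists_isGeneralizedInverseOn_localTensor hsmooth hsymm hrank
  have hinv (c : M) : ∀ u ∈ s c,
      IsGeneralizedInverseOn.IsInvolutiveAt (localTensor c Θ) (G c) u :=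
    fun u hu ↦ isInvolutiveAt_localTensor (hG c) (hst c) h hu
  let U (c : M) : Set M := (extChartAt (𝓡 n) c).source ∩ extChartAt (𝓡 n) c ⁻¹' s c
  have hU (c : M) : U c ⊆ (extChartAt (𝓡 n) c).source := inter_subset_left
  have : LocallyCompactSpace M := ChartedSpace.locallyCompactSpace (EuclideanSpace ℝ (Fin n)) M
  obtain ⟨ρ, hρ⟩ := SmoothPartitionOfUnity.exists_isSubordinate (𝓡 n) isClosed_univ U
    (fun c ↦ isOpen_extChartAt_preimage' c (hG c).isOpen)
    fun x _ ↦ mem_iUnion.2 ⟨x, mem_extChartAt_source x, hs x⟩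
  let Γ (c : M) := christoffel (localTensor c Θ) (G c)
  let cov : Connection n M := ⟨gluedCov Γ ρ, isCovariantDerivativeOn_gluedCov hρ hU⟩
  refine ⟨cov, ⟨⟨fun {Y} hY ↦ ?_⟩⟩, ?_, ?_⟩
  · exact (contMDiff_gluedCov hρ (fun c ↦ (hG c).isOpen) hst
      (fun c ↦ (hG c).contDiffOn_christoffel) (contMDiffOn_univ.1 hY)).contMDiffOn
  · refine cov.torsion_eq_zero_iff.2 fun hX hY ↦ gluedCov_sub_gluedCov hρ hU ?_ hX hY
    exact fun c x hx v w ↦ (hG c).christoffel_symm hx.2 (hinv c _ hx.2) v w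
  · exact gluedCov_tensor hsmooth hρ hU
      (fun c x hx X ξ ↦ (hG c).christoffel_parallel hx.2 (hinv c _ hx.2) X ξ) cov rfl

end Glueing

end

end SymTensor

theorem propositionE (n : ℕ) (M : Type*) [TopologicalSpace M] [T2Space M]
    [SecondCountableTopology M] [ChartedSpace (EuclideanSpace ℝ (Fin n)) M]
    [IsManifold (𝓡 n) ∞ M] (Θ : SymTensor.Tensor20 n M) (hsmooth : Θ.IsSmooth)
    (hsymm : Θ.IsSymmetric) (hrank : Θ.HasConstantRank) :
    Θ.IsIntegrable ↔ SymTensor.IsIntegrableDistribution Θ.image :=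
  ⟨SymTensor.isIntegrableDistribution_of_isIntegrable hsmooth hsymm hrank,
    SymTensor.isIntegrable_of_isIntegrableDistribution hsmooth hsymm hrank⟩
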